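/- Let $M$ be a smooth $n$-dimensional manifold, smoothly immersed as a minimal submanifold of $\mathbb R^{n+m}$ (mean curvature vector $H=\operatorname{tr}B\equiv0$), with second fundamental form $B$, and let $\nabla B$ be the covariant derivative of $B$ (with respect to the Levi-Civita connection of the induced metric and the normal connection). Assume that the Gauss map $p\mapsto T_pM$ of $M$ into the Grassmannian of $n$-planes has rank at most $2$ at every point ($G$-rank $\le 2$). Then $|B|$ is differentiable at every point where $B\neq0$, and at every point $p\in M$ at which $|B|$ is differentiable: 1. $$|\nabla B|^2\ \ge\ 2\,\big|\nabla|B|\big|^2 .$$ 2. If $n\ge2$, equality holds in (1) at $p$ if and only if there exist an orthonormal basis $\{e_1,\dots,e_n\}$ of $T_pM$ and $\lambda_1,\lambda_2\in\mathbb R$ such that $B_{e_ie_j}=0$ whenever $i\ge3$ or $j\ge3$; $\langle B_{e_1e_1},B_{e_1e_2}\rangle=0$; $(\nabla_{e_k}B)_{e_ie_j}=0$ whenever $i\ge3$, $j\ge3$ or $k\ge3$; and $$(\nabla_{e_1}B)_{e_1e_1}=\lambda_1B_{e_1e_1}-\lambda_2B_{e_1e_2},\qquad (\nabla_{e_2}B)_{e_1e_1}=\lambda_2B_{e_1e_1}+\lambda_1B_{e_1e_2}.$$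 3. If $n=2$ and $m=1$, then $|\nabla B|^2=2\,\big|\nabla|B|\big|^2$ at $p$. -/

import Mathlib

open scoped Manifold ContDiff RealInnerProductSpace

noncomputable section

/-! Local extrinsic geometry of an immersed submanifold, written in a local parametrization
`f` from (an open subset of) `ℝⁿ` to `ℝᴺ`.  A tangent vector of the submanifold at `f x` is
represented by the vector `u` of `ℝⁿ` of its components in the coordinate basis, i.e. `u` stands
for `df_x(u)`.  Normal vectors are vectors of `ℝᴺ`. -/

namespace MinSub

variable {n N : ℕ}

/-- The `i`-th standard basis vector of `ℝⁿ` (the coordinate field `∂ᵢ`). -/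
def basisVec (i : Fin n) : EuclideanSpace ℝ (Fin n) := EuclideanSpace.single i 1

/-- The induced metric (first fundamental form) `g_x(u, v) = ⟨df_x u, df_x v⟩`. -/
def metric (f : EuclideanSpace ℝ (Fin n) → EuclideanSpace ℝ (Fin N))
    (x u v : EuclideanSpace ℝ (Fin n)) : ℝ :=
  ⟪fderiv ℝ f x u, fderiv ℝ f x v⟫

/-- The matrix `(g_ij)` of the induced metric. -/
def metricMatrix (f : EuclideanSpace ℝ (Fin n) → EuclideanSpace ℝ (Fin N))
    (x : EuclideanSpace ℝ (Fin n)) : Matrix (Fin n) (Fin n) ℝ :=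
  Matrix.of fun i j => metric f x (basisVec i) (basisVec j)

/-- The inverse metric `g^{ij}`. -/
def invMetric (f : EuclideanSpace ℝ (Fin n) → EuclideanSpace ℝ (Fin N))
    (x : EuclideanSpace ℝ (Fin n)) (i j : Fin n) : ℝ :=
  (metricMatrix f x)⁻¹ i j

/-- The tangential component of `ξ ∈ ℝᴺ` at `f x`, in coordinates:
`∑ g^{ij} ⟨ξ, ∂ᵢf⟩ ∂ⱼ`. -/
def tangentialPart (f : EuclideanSpace ℝ (Fin n) → EuclideanSpace ℝ (Fin N))
    (x : EuclideanSpace ℝ (Fin n)) (ξ : EuclideanSpace ℝ (Fin N)) : EuclideanSpace ℝ (Fin n) :=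
  ∑ i, ∑ j, (invMetric f x i j * ⟪ξ, fderiv ℝ f x (basisVec i)⟫) • basisVec j

/-- The normal component of `ξ ∈ ℝᴺ` at `f x`. -/
def normalPart (f : EuclideanSpace ℝ (Fin n) → EuclideanSpace ℝ (Fin N))
    (x : EuclideanSpace ℝ (Fin n)) (ξ : EuclideanSpace ℝ (Fin N)) : EuclideanSpace ℝ (Fin N) :=
  ξ - fderiv ℝ f x (tangentialPart f x ξ)

/-- The ambient derivative `D_u (df(v)) = D²f_x(u, v)` for a constant coordinate field `v`. -/
def secondDeriv (f : EuclideanSpace ℝ (Fin n) → EuclideanSpace ℝ (Fin N))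
    (x u v : EuclideanSpace ℝ (Fin n)) : EuclideanSpace ℝ (Fin N) :=
  fderiv ℝ (fderiv ℝ f) x u v

/-- The Levi-Civita connection of the induced metric on constant coordinate fields,
`∇_u v = (D_u (df(v)))^T`; its components are the Christoffel symbols. -/
def leviCivita (f : EuclideanSpace ℝ (Fin n) → EuclideanSpace ℝ (Fin N))
    (x u v : EuclideanSpace ℝ (Fin n)) : EuclideanSpace ℝ (Fin n) :=
  tangentialPart f x (secondDeriv f x u v)

/-- The second fundamental form `B_{u v} = (D_u (df(v)))^⊥`. -/
def secondFundForm (f : EuclideanSpace ℝ (Fin n) → EuclideanSpace ℝ (Fin N))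
    (x u v : EuclideanSpace ℝ (Fin n)) : EuclideanSpace ℝ (Fin N) :=
  normalPart f x (secondDeriv f x u v)

/-- The covariant derivative of the second fundamental form,
`(∇_w B)_{u v} = ∇^⊥_w (B_{u v}) - B_{∇_w u, v} - B_{u, ∇_w v}` (for constant coordinate fields
`u, v`), where `∇^⊥` is the normal connection. -/
def covDerivB (f : EuclideanSpace ℝ (Fin n) → EuclideanSpace ℝ (Fin N))
    (x w u v : EuclideanSpace ℝ (Fin n)) : EuclideanSpace ℝ (Fin N) :=
  normalPart f x (fderiv ℝ (fun y => secondFundForm f y u v) x w)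
    - secondFundForm f x (leviCivita f x w u) v - secondFundForm f x u (leviCivita f x w v)

/-- The mean curvature vector `H = g^{ij} B_{ij}`, the trace of `B`. -/
def meanCurvature (f : EuclideanSpace ℝ (Fin n) → EuclideanSpace ℝ (Fin N))
    (x : EuclideanSpace ℝ (Fin n)) : EuclideanSpace ℝ (Fin N) :=
  ∑ i, ∑ j, invMetric f x i j • secondFundForm f x (basisVec i) (basisVec j)

/-- `|B|² = g^{ik} g^{jl} ⟨B_{ij}, B_{kl}⟩`. -/
def normSqB (f : EuclideanSpace ℝ (Fin n) → EuclideanSpace ℝ (Fin N))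
    (x : EuclideanSpace ℝ (Fin n)) : ℝ :=
  ∑ i, ∑ j, ∑ k, ∑ l, invMetric f x i k * invMetric f x j l *
    ⟪secondFundForm f x (basisVec i) (basisVec j), secondFundForm f x (basisVec k) (basisVec l)⟫

/-- `|B|`. -/
def normB (f : EuclideanSpace ℝ (Fin n) → EuclideanSpace ℝ (Fin N))
    (x : EuclideanSpace ℝ (Fin n)) : ℝ :=
  √(normSqB f x)

/-- `|∇B|² = g^{ai} g^{bj} g^{ck} ⟨(∇_a B)_{bc}, (∇_i B)_{jk}⟩`. -/
def normSqCovDerivB (f : EuclideanSpace ℝ (Fin n) → EuclideanSpace ℝ (Fin N))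
    (x : EuclideanSpace ℝ (Fin n)) : ℝ :=
  ∑ a, ∑ b, ∑ c, ∑ i, ∑ j, ∑ k, invMetric f x a i * invMetric f x b j * invMetric f x c k *
    ⟪covDerivB f x (basisVec a) (basisVec b) (basisVec c),
      covDerivB f x (basisVec i) (basisVec j) (basisVec k)⟫

/-- The squared length `|∇h|² = g^{ij} ∂ᵢh ∂ⱼh` of the Riemannian gradient of a function `h`. -/
def normSqGrad (f : EuclideanSpace ℝ (Fin n) → EuclideanSpace ℝ (Fin N))
    (h : EuclideanSpace ℝ (Fin n) → ℝ) (x : EuclideanSpace ℝ (Fin n)) : ℝ :=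
  ∑ i, ∑ j, invMetric f x i j * (fderiv ℝ h x (basisVec i) * fderiv ℝ h x (basisVec j))

/-- `e` is an orthonormal basis of the tangent space for the induced metric. -/
def IsOrthonormalFrame (f : EuclideanSpace ℝ (Fin n) → EuclideanSpace ℝ (Fin N))
    (x : EuclideanSpace ℝ (Fin n)) (e : Fin n → EuclideanSpace ℝ (Fin n)) : Prop :=
  ∀ i j, metric f x (e i) (e j) = if i = j then 1 else 0

/-- The determinant as a continuous alternating form on `ℝⁿ`. -/
def detForm (n : ℕ) : (Fin n → ℝ) [⋀^Fin n]→L[ℝ] ℝ :=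
  { (Matrix.detRowAlternating : (Fin n → ℝ) [⋀^Fin n]→ₗ[ℝ] ℝ) with
    cont := by
      change Continuous fun A : Matrix (Fin n) (Fin n) ℝ => A.det
      exact Continuous.matrix_det continuous_id }

/-- The Gauss map `x ↦ e₁ ∧ ⋯ ∧ eₙ = (∂₁f ∧ ⋯ ∧ ∂ₙf) / √det(g_ij)` into the Grassmannian of
oriented `n`-planes, realized (Plücker embedding) as the unit simple `n`-vectors.  An `n`-vector
`ω` is represented by the alternating form `(v₁, …, vₙ) ↦ ⟨ω, v₁ ∧ ⋯ ∧ vₙ⟩`, where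
`⟨a₁ ∧ ⋯ ∧ aₙ, v₁ ∧ ⋯ ∧ vₙ⟩ = det ⟨aᵢ, vⱼ⟩`. -/
def gaussMap (f : EuclideanSpace ℝ (Fin n) → EuclideanSpace ℝ (Fin N))
    (x : EuclideanSpace ℝ (Fin n)) : EuclideanSpace ℝ (Fin N) [⋀^Fin n]→L[ℝ] ℝ :=
  (√(metricMatrix f x).det)⁻¹ • (detForm n).compContinuousLinearMap
    (ContinuousLinearMap.pi fun i => innerSL ℝ (fderiv ℝ f x (basisVec i)))

/-- The rank of the differential of the Gauss map. -/
def gaussRank (f : EuclideanSpace ℝ (Fin n) → EuclideanSpace ℝ (Fin N))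
    (x : EuclideanSpace ℝ (Fin n)) : ℕ :=
  Module.finrank ℝ (fderiv ℝ (gaussMap f) x).range

/-- The local parametrization of the immersed submanifold `F : M → ℝᴺ` given by a chart. -/
def localParam {M : Type*} [TopologicalSpace M] (F : M → EuclideanSpace ℝ (Fin N))
    (φ : OpenPartialHomeomorph M (EuclideanSpace ℝ (Fin n))) :
    EuclideanSpace ℝ (Fin n) → EuclideanSpace ℝ (Fin N) :=
  F ∘ φ.symm

/-- `F` is a smooth immersion of the `n`-manifold `M`. -/
structure IsSmoothImmersion (n : ℕ) {N : ℕ} {M : Type*} [TopologicalSpace M]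
    [ChartedSpace (EuclideanSpace ℝ (Fin n)) M] (F : M → EuclideanSpace ℝ (Fin N)) : Prop where
  smooth : ContMDiff (𝓡 n) 𝓘(ℝ, EuclideanSpace ℝ (Fin N)) ∞ F
  immersion : ∀ p, Function.Injective (mfderiv (𝓡 n) 𝓘(ℝ, EuclideanSpace ℝ (Fin N)) F p)

/-- The mean curvature vector vanishes everywhere (in every smooth chart). -/
def IsMinimal (n : ℕ) {N : ℕ} {M : Type*} [TopologicalSpace M]
    [ChartedSpace (EuclideanSpace ℝ (Fin n)) M] (F : M → EuclideanSpace ℝ (Fin N)) : Prop :=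
  ∀ φ ∈ IsManifold.maximalAtlas (𝓡 n) ∞ M, ∀ x ∈ φ.target, meanCurvature (localParam F φ) x = 0

/-- The Gauss map has rank at most `r` everywhere (in every smooth chart). -/
def GRankLE (n : ℕ) {N : ℕ} {M : Type*} [TopologicalSpace M]
    [ChartedSpace (EuclideanSpace ℝ (Fin n)) M] (F : M → EuclideanSpace ℝ (Fin N)) (r : ℕ) : Prop :=
  ∀ φ ∈ IsManifold.maximalAtlas (𝓡 n) ∞ M, ∀ x ∈ φ.target, gaussRank (localParam F φ) x ≤ r

/-- The structure of `B` and `∇B` at a point which characterizes equality: there are an orthonormal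
basis `e₁, …, eₙ` of the tangent space (indexed from `0` here) and `l₁, l₂ ∈ ℝ` such that
`B_{eᵢ eⱼ} = 0` if `i ≥ 3` or `j ≥ 3`, `⟨B_{e₁e₁}, B_{e₁e₂}⟩ = 0`,
`(∇_{e_k} B)_{eᵢ eⱼ} = 0` if `i ≥ 3`, `j ≥ 3` or `k ≥ 3`, and
`(∇_{e₁} B)_{e₁e₁} = l₁ B_{e₁e₁} - l₂ B_{e₁e₂}`,
`(∇_{e₂} B)_{e₁e₁} = l₂ B_{e₁e₁} + l₁ B_{e₁e₂}`. -/
def EqualityStructure (hn : 2 ≤ n) (f : EuclideanSpace ℝ (Fin n) → EuclideanSpace ℝ (Fin N))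
    (x : EuclideanSpace ℝ (Fin n)) : Prop :=
  ∃ e : Fin n → EuclideanSpace ℝ (Fin n), IsOrthonormalFrame f x e ∧ ∃ l₁ l₂ : ℝ,
    let e₁ := e ⟨0, by omega⟩
    let e₂ := e ⟨1, by omega⟩
    (∀ i j : Fin n, (2 ≤ i.val ∨ 2 ≤ j.val) → secondFundForm f x (e i) (e j) = 0) ∧
    ⟪secondFundForm f x e₁ e₁, secondFundForm f x e₁ e₂⟫ = 0 ∧
    (∀ i j k : Fin n, (2 ≤ i.val ∨ 2 ≤ j.val ∨ 2 ≤ k.val) →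
      covDerivB f x (e k) (e i) (e j) = 0) ∧
    covDerivB f x e₁ e₁ e₁ = l₁ • secondFundForm f x e₁ e₁ - l₂ • secondFundForm f x e₁ e₂ ∧
    covDerivB f x e₂ e₁ e₁ = l₂ • secondFundForm f x e₁ e₁ + l₁ • secondFundForm f x e₁ e₂

end MinSub

end

/-!
The refined Kato inequality `|∇B|² ≥ 2 |∇|B||²` for a minimal submanifold whose Gauss map has rank
at most two. Everything is local, so it is proved for a parametrization `f` of an open set
(`MinSub.kato_of_isOpen`).

The differential of the Gauss map in the direction `w` is `v ↦ B_{w v}`; testing it on suitable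
`n`-vectors shows that its kernel lies in the relative nullity `{w | B_{w ·} = 0}`
(`secondFundForm_eq_zero_of_fderiv_gaussMap_eq_zero`). Hence some orthonormal frame `e₁, …, eₙ` has
`e₃, …, eₙ` in the nullity, and `B₂₂ = -B₁₁` by minimality. At a point with `B ≠ 0` the map
`w ↦ B_{w ·}` has rank exactly two there and at most two nearby, so its `3 × 3` minors vanish
identically; differentiating one of them shows that `∇B` vanishes on pairs of nullity vectors
(`covDerivB_eq_zero_of_nullity`). Since `∇B` is totally symmetric by the Codazzi equation
(`covDerivB_comm_left`) and trace free (`sum_covDerivB_eq_zero`), it is determined by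
`X = (∇₁B)₁₁`, `Y = (∇₁B)₁₂` and the components `(∇ᵢB)₁₁`, `(∇ᵢB)₁₂` with `i ≥ 3`, and the latter are
counted three times in `|∇B|²` but only once in `|∇|B||²`.

Put `A = B₁₁ + i B₁₂` and `Z = X + i Y`. Then `|B|² = 2 |A|²`, the first two derivatives of `|B|²`
are the real and imaginary parts of `4 ⟨Z, A⟩`, and the inequality reduces to the Cauchy–Schwarz
inequality `|⟨Z, A⟩| ≤ |Z| |A|` in the complexified normal space, together with a strict
Cauchy–Schwarz estimate for the components with `i ≥ 3` (`IsAdaptedFrame.kato_defect`). Equality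
therefore means that these components vanish and that `Z` is a complex multiple `l₁ + i l₂` of `A`
(`IsAdaptedFrame.kato_eq_iff`); a rotation of `e₁, e₂` makes `B₁₁` and `B₁₂` orthogonal. For a
surface of codimension one the normal space is a line, so `Z` is always a multiple of `A`.

At a zero of `B` where `|B|` is differentiable, `|B|` has a critical minimum, hence is
`o(|y - x|)`, and since it dominates `B` also `∇B = 0` there (`covDerivB_eq_zero_of_normB_eq_zero`);
all statements are then trivial.
-/

namespace MinSub

variable {n N : ℕ}

/-! ### Orthonormal frames of the tangent space -/

section Frame

variable {f : EuclideanSpace ℝ (Fin n) → EuclideanSpace ℝ (Fin N)} {x : EuclideanSpace ℝ (Fin n)}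
  {e : Fin n → EuclideanSpace ℝ (Fin n)}

lemma sum_smul_basisVec (u : EuclideanSpace ℝ (Fin n)) : ∑ i, u i • basisVec i = u := by
  ext j
  simp [basisVec, Pi.single_apply]

/-- The metric in coordinates. -/
lemma metric_eq_sum (f : EuclideanSpace ℝ (Fin n) → EuclideanSpace ℝ (Fin N))
    (x u v : EuclideanSpace ℝ (Fin n)) :
    metric f x u v = ∑ i, ∑ j, u i * metricMatrix f x i j * v j := by
  conv_lhs => rw [← sum_smul_basisVec u, ← sum_smul_basisVec v]
  simp only [metric, metricMatrix, map_sum, map_smul, sum_inner, inner_sum, real_inner_smul_left,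
    real_inner_smul_right, Matrix.of_apply]
  rw [Finset.sum_comm]
  refine Finset.sum_congr rfl fun i _ => Finset.sum_congr rfl fun j _ => ?_
  ring

lemma metricMatrix_mul_eq_one (he : IsOrthonormalFrame f x e) :
    metricMatrix f x * ((Matrix.of fun k i => e k i).transpose * Matrix.of fun k i => e k i)
      = 1 := by
  set A : Matrix (Fin n) (Fin n) ℝ := Matrix.of fun k i => e k i
  have h : A * (metricMatrix f x * A.transpose) = 1 := by
    ext k l
    have := he k l
    rw [metric_eq_sum] at this
    rw [← Matrix.mul_assoc, Matrix.mul_apply, Matrix.one_apply, ← this, Finset.sum_comm]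
    refine Finset.sum_congr rfl fun i _ => ?_
    simp [Matrix.mul_apply, A, Finset.sum_mul]
  rw [← Matrix.mul_assoc]
  exact mul_eq_one_comm.mp h

/-- In terms of an orthonormal frame, the inverse metric is `∑ₖ eₖ ⊗ eₖ`. -/
lemma invMetric_eq_sum (he : IsOrthonormalFrame f x e) (i j : Fin n) :
    invMetric f x i j = ∑ k, e k i * e k j := by
  rw [invMetric, Matrix.inv_eq_right_inv (metricMatrix_mul_eq_one he)]
  simp [Matrix.mul_apply]

/-- A bilinear map in coordinates. -/
lemma sum_mul_smul_basisVec {W : Type*} [AddCommGroup W] [Module ℝ W]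
    (Q : EuclideanSpace ℝ (Fin n) →ₗ[ℝ] EuclideanSpace ℝ (Fin n) →ₗ[ℝ] W)
    (u v : EuclideanSpace ℝ (Fin n)) :
    ∑ i, ∑ j, (u i * v j) • Q (basisVec i) (basisVec j) = Q u v := by
  conv_rhs => rw [← sum_smul_basisVec u, ← sum_smul_basisVec v]
  simp only [map_sum, map_smul, LinearMap.sum_apply, LinearMap.smul_apply, Finset.smul_sum,
    smul_smul]
  rw [Finset.sum_comm]
  refine Finset.sum_congr rfl fun i _ => Finset.sum_congr rfl fun j _ => ?_
  rw [mul_comm]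

/-- The trace of a bilinear map with respect to the metric can be computed in any orthonormal
frame. -/
lemma sum_invMetric_smul {W : Type*} [AddCommGroup W] [Module ℝ W]
    (he : IsOrthonormalFrame f x e)
    (Q : EuclideanSpace ℝ (Fin n) →ₗ[ℝ] EuclideanSpace ℝ (Fin n) →ₗ[ℝ] W) :
    ∑ i, ∑ j, invMetric f x i j • Q (basisVec i) (basisVec j) = ∑ k, Q (e k) (e k) := by
  simp only [← sum_mul_smul_basisVec Q (e _) (e _), invMetric_eq_sum he, Finset.sum_smul]
  rw [Finset.sum_comm]
  rw [Finset.sum_comm]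
  conv_rhs => rw [Finset.sum_comm]
  refine Finset.sum_congr rfl fun i _ => ?_
  rw [Finset.sum_comm]

/-- The expansion of a tangent vector in an orthonormal frame. -/
lemma sum_metric_smul (he : IsOrthonormalFrame f x e) (u : EuclideanSpace ℝ (Fin n)) :
    ∑ k, metric f x u (e k) • e k = u := by
  have h := mul_eq_one_comm.mp (metricMatrix_mul_eq_one he)
  ext j
  have hj : u j = ∑ i, u i * (1 : Matrix (Fin n) (Fin n) ℝ) j i := by
    simp [Matrix.one_apply]
  rw [hj, ← h]
  have hsym : ∀ a b, metricMatrix f x a b = metricMatrix f x b a := fun a b => by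
    simp [metricMatrix, metric, real_inner_comm]
  simp only [metric_eq_sum, Matrix.mul_apply, Matrix.transpose_apply, Matrix.of_apply,
    smul_eq_mul, WithLp.ofLp_sum, Finset.sum_apply, WithLp.ofLp_smul,
    Pi.smul_apply, Finset.sum_mul, Finset.mul_sum]
  rw [Finset.sum_comm]
  refine Finset.sum_congr rfl fun i _ => ?_
  rw [Finset.sum_comm]
  refine Finset.sum_congr rfl fun a _ => Finset.sum_congr rfl fun k _ => ?_
  rw [hsym a i]
  ring

lemma tangentialPart_eq_sum (he : IsOrthonormalFrame f x e) (ξ : EuclideanSpace ℝ (Fin N)) :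
    tangentialPart f x ξ = ∑ k, ⟪ξ, fderiv ℝ f x (e k)⟫ • e k := by
  let Q : EuclideanSpace ℝ (Fin n) →ₗ[ℝ] EuclideanSpace ℝ (Fin n) →ₗ[ℝ]
      EuclideanSpace ℝ (Fin n) :=
    LinearMap.mk₂ ℝ (fun u v => ⟪ξ, fderiv ℝ f x u⟫ • v)
      (fun _ _ _ => by simp [inner_add_right, add_smul])
      (fun _ _ _ => by simp [inner_smul_right, mul_smul])
      (fun _ _ _ => smul_add _ _ _) (fun _ _ _ => smul_comm _ _ _)
  have := sum_invMetric_smul he Q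
  simpa [Q, tangentialPart, mul_smul] using this

lemma tangentialPart_add (ξ η : EuclideanSpace ℝ (Fin N)) :
    tangentialPart f x (ξ + η) = tangentialPart f x ξ + tangentialPart f x η := by
  simp [tangentialPart, inner_add_left, mul_add, add_smul, Finset.sum_add_distrib]

lemma tangentialPart_smul (c : ℝ) (ξ : EuclideanSpace ℝ (Fin N)) :
    tangentialPart f x (c • ξ) = c • tangentialPart f x ξ := by
  simp [tangentialPart, inner_smul_left, Finset.smul_sum, smul_smul, mul_left_comm]

lemma normalPart_add (ξ η : EuclideanSpace ℝ (Fin N)) :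
    normalPart f x (ξ + η) = normalPart f x ξ + normalPart f x η := by
  simp only [normalPart, tangentialPart_add, map_add]
  abel

lemma normalPart_smul (c : ℝ) (ξ : EuclideanSpace ℝ (Fin N)) :
    normalPart f x (c • ξ) = c • normalPart f x ξ := by
  simp only [normalPart, tangentialPart_smul, map_smul, smul_sub]

/-- The normal projection as a linear map. -/
noncomputable def normalPartₗ (f : EuclideanSpace ℝ (Fin n) → EuclideanSpace ℝ (Fin N))
    (x : EuclideanSpace ℝ (Fin n)) : EuclideanSpace ℝ (Fin N) →ₗ[ℝ] EuclideanSpace ℝ (Fin N) where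
  toFun := normalPart f x
  map_add' := normalPart_add
  map_smul' := normalPart_smul

@[simp]
lemma normalPartₗ_apply (ξ : EuclideanSpace ℝ (Fin N)) :
    normalPartₗ f x ξ = normalPart f x ξ := rfl

lemma normalPart_sub (ξ η : EuclideanSpace ℝ (Fin N)) :
    normalPart f x (ξ - η) = normalPart f x ξ - normalPart f x η :=
  map_sub (normalPartₗ f x) ξ η

@[simp]
lemma normalPart_zero : normalPart f x 0 = 0 := map_zero (normalPartₗ f x)

lemma tangentialPart_fderiv (he : IsOrthonormalFrame f x e) (u : EuclideanSpace ℝ (Fin n)) :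
    tangentialPart f x (fderiv ℝ f x u) = u := by
  rw [tangentialPart_eq_sum he]
  exact sum_metric_smul he u

lemma normalPart_fderiv (he : IsOrthonormalFrame f x e) (u : EuclideanSpace ℝ (Fin n)) :
    normalPart f x (fderiv ℝ f x u) = 0 := by
  rw [normalPart, tangentialPart_fderiv he, sub_self]

/-- `df (ξᵀ)` and `ξ` have the same inner products with tangent vectors. -/
lemma metric_tangentialPart (he : IsOrthonormalFrame f x e) (ξ : EuclideanSpace ℝ (Fin N))
    (u : EuclideanSpace ℝ (Fin n)) :
    metric f x (tangentialPart f x ξ) u = ⟪ξ, fderiv ℝ f x u⟫ := by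
  conv_rhs => rw [← sum_metric_smul he u]
  rw [tangentialPart_eq_sum he]
  simp only [metric, map_sum, map_smul, sum_inner, inner_sum, real_inner_smul_left,
    real_inner_smul_right]
  refine Finset.sum_congr rfl fun k _ => ?_
  rw [real_inner_comm (fderiv ℝ f x u)]
  ring

lemma inner_normalPart_fderiv (he : IsOrthonormalFrame f x e) (ξ : EuclideanSpace ℝ (Fin N))
    (u : EuclideanSpace ℝ (Fin n)) : ⟪normalPart f x ξ, fderiv ℝ f x u⟫ = 0 := by
  have := metric_tangentialPart he ξ u
  rw [metric] at this
  rw [normalPart, inner_sub_left, this, sub_self]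

/-- The normal projection is orthogonal: against a normal vector only the normal part matters. -/
lemma inner_normalPart_right {ν : EuclideanSpace ℝ (Fin N)}
    (hν : ∀ u, ⟪ν, fderiv ℝ f x u⟫ = 0) (ξ : EuclideanSpace ℝ (Fin N)) :
    ⟪ν, normalPart f x ξ⟫ = ⟪ν, ξ⟫ := by
  rw [normalPart, inner_sub_right, hν, sub_zero]

lemma normalPart_eq_self {ν : EuclideanSpace ℝ (Fin N)}
    (hν : ∀ u, ⟪ν, fderiv ℝ f x u⟫ = 0) : normalPart f x ν = ν := by
  simp [normalPart, tangentialPart, hν]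

/-- An immersed `n`-plane has an orthonormal frame adapted to a given subspace `K` of codimension
at most two: all frame vectors but the first two lie in `K`. -/
lemma exists_isOrthonormalFrame_adapted (hinj : Function.Injective (fderiv ℝ f x))
    (K : Submodule ℝ (EuclideanSpace ℝ (Fin n))) (hK : n ≤ Module.finrank ℝ K + 2) :
    ∃ e, IsOrthonormalFrame f x e ∧ ∀ i : Fin n, 2 ≤ i.val → e i ∈ K := by
  let D : EuclideanSpace ℝ (Fin n) →ₗ[ℝ] EuclideanSpace ℝ (Fin N) := (fderiv ℝ f x).toLinearMap
  have hD : Function.Injective D := hinj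
  let Φ : EuclideanSpace ℝ (Fin n) ≃ₗ[ℝ] LinearMap.range D := LinearEquiv.ofInjective D hD
  let T := LinearMap.range D
  let K' : Submodule ℝ T := K.map Φ.toLinearMap
  have hK' : Module.finrank ℝ K' = Module.finrank ℝ K := LinearEquiv.finrank_map_eq Φ K
  have hT : Module.finrank ℝ T = Fintype.card (Fin n) := by
    rw [← Φ.finrank_eq]; simp
  let b := stdOrthonormalBasis ℝ K'
  let s : Set (Fin n) := {i | 2 ≤ i.val}
  have hlt : ∀ i : s, i.1.val - 2 < Module.finrank ℝ K' := by
    rintro ⟨i, hi⟩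
    have := i.2
    have hi' : 2 ≤ i.val := hi
    change i.val - 2 < _
    omega
  let v : Fin n → T := fun i =>
    if h : i.val - 2 < Module.finrank ℝ K' then (b ⟨i.val - 2, h⟩ : T) else 0
  have hv : Orthonormal ℝ (s.domRestrict v) := by
    have h1 : s.domRestrict v = fun i : s => ((b ⟨i.1.val - 2, hlt i⟩ : K') : T) := by
      funext i
      simp [v, hlt i]
    rw [h1]
    have h2 : Orthonormal ℝ (fun i => ((b i : K') : T)) :=
      b.orthonormal.comp_linearIsometry K'.subtypeₗᵢ
    refine h2.comp (fun i : s => ⟨i.1.val - 2, hlt i⟩) ?_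
    rintro ⟨i, hi⟩ ⟨j, hj⟩ hij
    have hi' : 2 ≤ i.val := hi
    have hj' : 2 ≤ j.val := hj
    simp only [Fin.mk.injEq] at hij
    ext
    simp only
    omega
  obtain ⟨B, hB⟩ := hv.exists_orthonormalBasis_extension_of_card_eq hT
  have hΦ : ∀ t : T, fderiv ℝ f x (Φ.symm t) = (t : EuclideanSpace ℝ (Fin N)) := fun t => by
    have : ((Φ (Φ.symm t) : T) : EuclideanSpace ℝ (Fin N)) = t := by simp
    exact this
  refine ⟨fun i => Φ.symm (B i), ?_, ?_⟩
  · intro i j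
    rw [metric, hΦ, hΦ]
    exact orthonormal_iff_ite.mp B.orthonormal i j
  · intro i hi
    have hmem : B i ∈ K' := by
      rw [hB i hi]
      simp only [v, hlt ⟨i, hi⟩, dite_true]
      exact Subtype.prop _
    obtain ⟨w, hw, hw'⟩ := hmem
    change Φ.symm (B i) ∈ K
    rw [← hw']
    simpa using hw

lemma exists_isOrthonormalFrame (hinj : Function.Injective (fderiv ℝ f x)) :
    ∃ e, IsOrthonormalFrame f x e := by
  obtain ⟨e, he, -⟩ := exists_isOrthonormalFrame_adapted hinj ⊤ (by simp)
  exact ⟨e, he⟩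

end Frame

/-! ### The second fundamental form as a bilinear map -/

section Bilinear

variable {f : EuclideanSpace ℝ (Fin n) → EuclideanSpace ℝ (Fin N)} {x : EuclideanSpace ℝ (Fin n)}
  {e : Fin n → EuclideanSpace ℝ (Fin n)}

/-- The second fundamental form at a point as a bilinear map. -/
noncomputable def secondFundFormₗ (f : EuclideanSpace ℝ (Fin n) → EuclideanSpace ℝ (Fin N))
    (x : EuclideanSpace ℝ (Fin n)) :
    EuclideanSpace ℝ (Fin n) →ₗ[ℝ] EuclideanSpace ℝ (Fin n) →ₗ[ℝ] EuclideanSpace ℝ (Fin N) :=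
  LinearMap.mk₂ ℝ (secondFundForm f x)
    (fun _ _ _ => by simp [secondFundForm, secondDeriv, normalPart_add])
    (fun _ _ _ => by simp [secondFundForm, secondDeriv, normalPart_smul])
    (fun _ _ _ => by simp [secondFundForm, secondDeriv, normalPart_add])
    (fun _ _ _ => by simp [secondFundForm, secondDeriv, normalPart_smul])

@[simp]
lemma secondFundFormₗ_apply (u v : EuclideanSpace ℝ (Fin n)) :
    secondFundFormₗ f x u v = secondFundForm f x u v := rfl

/-- The Levi-Civita connection on constant coordinate fields as a bilinear map. -/
noncomputable def leviCivitaₗ (f : EuclideanSpace ℝ (Fin n) → EuclideanSpace ℝ (Fin N))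
    (x : EuclideanSpace ℝ (Fin n)) :
    EuclideanSpace ℝ (Fin n) →ₗ[ℝ] EuclideanSpace ℝ (Fin n) →ₗ[ℝ] EuclideanSpace ℝ (Fin n) :=
  LinearMap.mk₂ ℝ (leviCivita f x)
    (fun _ _ _ => by simp [leviCivita, secondDeriv, tangentialPart_add])
    (fun _ _ _ => by simp [leviCivita, secondDeriv, tangentialPart_smul])
    (fun _ _ _ => by simp [leviCivita, secondDeriv, tangentialPart_add])
    (fun _ _ _ => by simp [leviCivita, secondDeriv, tangentialPart_smul])

@[simp]
lemma leviCivitaₗ_apply (u v : EuclideanSpace ℝ (Fin n)) :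
    leviCivitaₗ f x u v = leviCivita f x u v := rfl

lemma inner_secondFundForm_fderiv (he : IsOrthonormalFrame f x e)
    (u v w : EuclideanSpace ℝ (Fin n)) : ⟪secondFundForm f x u v, fderiv ℝ f x w⟫ = 0 :=
  inner_normalPart_fderiv he _ _

lemma normalPart_secondFundForm (he : IsOrthonormalFrame f x e)
    (u v : EuclideanSpace ℝ (Fin n)) :
    normalPart f x (secondFundForm f x u v) = secondFundForm f x u v :=
  normalPart_eq_self (inner_secondFundForm_fderiv he u v)

lemma inner_covDerivB_fderiv (he : IsOrthonormalFrame f x e)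
    (w u v z : EuclideanSpace ℝ (Fin n)) : ⟪covDerivB f x w u v, fderiv ℝ f x z⟫ = 0 := by
  simp [covDerivB, inner_sub_left, inner_normalPart_fderiv he, inner_secondFundForm_fderiv he]

end Bilinear

/-! ### Smoothness -/

section Smooth

variable {f : EuclideanSpace ℝ (Fin n) → EuclideanSpace ℝ (Fin N)} {x : EuclideanSpace ℝ (Fin n)}
  {e : Fin n → EuclideanSpace ℝ (Fin n)}

lemma contDiffAt_fderiv_apply (hf : ContDiffAt ℝ ∞ f x) (u : EuclideanSpace ℝ (Fin n)) :
    ContDiffAt ℝ ∞ (fun y => fderiv ℝ f y u) x :=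
  (hf.fderiv_right (m := ∞) (by simp)).clm_apply contDiffAt_const

lemma contDiffAt_secondDeriv (hf : ContDiffAt ℝ ∞ f x) (u v : EuclideanSpace ℝ (Fin n)) :
    ContDiffAt ℝ ∞ (fun y => secondDeriv f y u v) x :=
  (((hf.fderiv_right (m := ∞) (by simp)).fderiv_right (m := ∞) (by simp)).clm_apply
    contDiffAt_const).clm_apply contDiffAt_const

lemma contDiffAt_metric (hf : ContDiffAt ℝ ∞ f x) (u v : EuclideanSpace ℝ (Fin n)) :
    ContDiffAt ℝ ∞ (fun y => metric f y u v) x :=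
  (contDiffAt_fderiv_apply hf u).inner ℝ (contDiffAt_fderiv_apply hf v)

lemma contDiffAt_det {E : Type*} [NormedAddCommGroup E] [NormedSpace ℝ E] {k : ℕ} {x : E}
    {A : E → Matrix (Fin k) (Fin k) ℝ} (hA : ∀ i j, ContDiffAt ℝ ∞ (fun y => A y i j) x) :
    ContDiffAt ℝ ∞ (fun y => (A y).det) x := by
  simp only [Matrix.det_apply]
  refine ContDiffAt.sum fun σ _ => ContDiffAt.const_smul _ ?_
  exact contDiffAt_prod fun i _ => hA _ _

lemma det_metricMatrix_ne_zero (he : IsOrthonormalFrame f x e) : (metricMatrix f x).det ≠ 0 := by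
  have h := congrArg Matrix.det (metricMatrix_mul_eq_one he)
  rw [Matrix.det_mul, Matrix.det_one] at h
  exact left_ne_zero_of_mul_eq_one h

lemma contDiffAt_invMetric (hf : ContDiffAt ℝ ∞ f x) (he : IsOrthonormalFrame f x e)
    (i j : Fin n) : ContDiffAt ℝ ∞ (fun y => invMetric f y i j) x := by
  simp only [invMetric, Matrix.inv_def, Ring.inverse_eq_inv', Matrix.smul_apply, smul_eq_mul,
    Matrix.adjugate_apply]
  have hG : ∀ i j, ContDiffAt ℝ ∞ (fun y => metricMatrix f y i j) x := fun i j =>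
    contDiffAt_metric hf _ _
  refine ((contDiffAt_det hG).inv (det_metricMatrix_ne_zero he)).mul (contDiffAt_det ?_)
  intro a b
  simp only [Matrix.updateRow_apply]
  split_ifs
  · exact contDiffAt_const
  · exact hG _ _

lemma contDiffAt_tangentialPart (hf : ContDiffAt ℝ ∞ f x) (he : IsOrthonormalFrame f x e)
    {ξ : EuclideanSpace ℝ (Fin n) → EuclideanSpace ℝ (Fin N)} (hξ : ContDiffAt ℝ ∞ ξ x) :
    ContDiffAt ℝ ∞ (fun y => tangentialPart f y (ξ y)) x := by
  unfold tangentialPart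
  refine ContDiffAt.sum fun i _ => ContDiffAt.sum fun j _ => ?_
  exact ((contDiffAt_invMetric hf he i j).mul
    (hξ.inner ℝ (contDiffAt_fderiv_apply hf _))).smul contDiffAt_const

lemma contDiffAt_leviCivita (hf : ContDiffAt ℝ ∞ f x) (he : IsOrthonormalFrame f x e)
    (u v : EuclideanSpace ℝ (Fin n)) : ContDiffAt ℝ ∞ (fun y => leviCivita f y u v) x :=
  contDiffAt_tangentialPart hf he (contDiffAt_secondDeriv hf u v)

lemma contDiffAt_secondFundForm (hf : ContDiffAt ℝ ∞ f x) (he : IsOrthonormalFrame f x e)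
    (u v : EuclideanSpace ℝ (Fin n)) : ContDiffAt ℝ ∞ (fun y => secondFundForm f y u v) x :=
  (contDiffAt_secondDeriv hf u v).sub
    ((hf.fderiv_right (m := ∞) (by simp)).clm_apply (contDiffAt_leviCivita hf he u v))

lemma differentiableAt_secondFundForm (hf : ContDiffAt ℝ ∞ f x) (he : IsOrthonormalFrame f x e)
    (u v : EuclideanSpace ℝ (Fin n)) :
    DifferentiableAt ℝ (fun y => secondFundForm f y u v) x :=
  (contDiffAt_secondFundForm hf he u v).differentiableAt (by simp)

lemma contDiffAt_normSqB (hf : ContDiffAt ℝ ∞ f x) (he : IsOrthonormalFrame f x e) :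
    ContDiffAt ℝ ∞ (normSqB f) x := by
  unfold normSqB
  refine ContDiffAt.sum fun i _ => ContDiffAt.sum fun j _ => ContDiffAt.sum fun k _ =>
    ContDiffAt.sum fun l _ => ?_
  exact ((contDiffAt_invMetric hf he i k).mul (contDiffAt_invMetric hf he j l)).mul
    ((contDiffAt_secondFundForm hf he _ _).inner ℝ (contDiffAt_secondFundForm hf he _ _))

/-- `|B|` is differentiable wherever it does not vanish. -/
lemma differentiableAt_normB (hf : ContDiffAt ℝ ∞ f x) (he : IsOrthonormalFrame f x e)
    (h0 : normB f x ≠ 0) : DifferentiableAt ℝ (normB f) x := by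
  have h : normSqB f x ≠ 0 := fun h => h0 (by simp [normB, h])
  exact ((contDiffAt_normSqB hf he).differentiableAt (by simp)).sqrt h

lemma minSmoothness_two_le_infty : minSmoothness ℝ 2 ≤ (∞ : ℕ∞ω) := by
  rw [minSmoothness_of_isRCLikeNormedField]
  exact WithTop.coe_le_coe.2 (le_top : (2 : ℕ∞) ≤ ⊤)

lemma secondDeriv_comm (hf : ContDiffAt ℝ ∞ f x) (u v : EuclideanSpace ℝ (Fin n)) :
    secondDeriv f x u v = secondDeriv f x v u :=
  (hf.isSymmSndFDerivAt minSmoothness_two_le_infty).eq u v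

lemma leviCivita_comm (hf : ContDiffAt ℝ ∞ f x) (u v : EuclideanSpace ℝ (Fin n)) :
    leviCivita f x u v = leviCivita f x v u := by
  rw [leviCivita, secondDeriv_comm hf, leviCivita]

lemma secondFundForm_comm (hf : ContDiffAt ℝ ∞ f x) (u v : EuclideanSpace ℝ (Fin n)) :
    secondFundForm f x u v = secondFundForm f x v u := by
  rw [secondFundForm, secondDeriv_comm hf, secondFundForm]

end Smooth

/-! ### Covariant derivatives and the Codazzi equation -/

section CovDeriv

variable {f : EuclideanSpace ℝ (Fin n) → EuclideanSpace ℝ (Fin N)} {x : EuclideanSpace ℝ (Fin n)}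
  {e : Fin n → EuclideanSpace ℝ (Fin n)}

/-- The derivative `∂_w (B_{u v})` at a point, as a bilinear map in the constant fields
`u`, `v`. -/
noncomputable def dirDerivB (hf : ContDiffAt ℝ ∞ f x) (he : IsOrthonormalFrame f x e)
    (w : EuclideanSpace ℝ (Fin n)) :
    EuclideanSpace ℝ (Fin n) →ₗ[ℝ] EuclideanSpace ℝ (Fin n) →ₗ[ℝ] EuclideanSpace ℝ (Fin N) :=
  LinearMap.mk₂ ℝ (fun u v => fderiv ℝ (fun y => secondFundForm f y u v) x w)
    (fun u u' v => by
      simp only [← secondFundFormₗ_apply, map_add, LinearMap.add_apply]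
      exact congrArg (· w) (fderiv_fun_add (differentiableAt_secondFundForm hf he u v)
        (differentiableAt_secondFundForm hf he u' v)))
    (fun c u v => by
      simp only [← secondFundFormₗ_apply, map_smul, LinearMap.smul_apply]
      exact congrArg (· w) (fderiv_fun_const_smul (differentiableAt_secondFundForm hf he u v) c))
    (fun u v v' => by
      simp only [← secondFundFormₗ_apply, map_add]
      exact congrArg (· w) (fderiv_fun_add (differentiableAt_secondFundForm hf he u v)
        (differentiableAt_secondFundForm hf he u v')))
    (fun c u v => by
      simp only [← secondFundFormₗ_apply, map_smul]
      exact congrArg (· w) (fderiv_fun_const_smul (differentiableAt_secondFundForm hf he u v) c))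

lemma covDerivB_eq (hf : ContDiffAt ℝ ∞ f x) (he : IsOrthonormalFrame f x e)
    (w u v : EuclideanSpace ℝ (Fin n)) :
    covDerivB f x w u v = normalPartₗ f x (dirDerivB hf he w u v)
      - secondFundFormₗ f x (leviCivitaₗ f x w u) v
      - secondFundFormₗ f x u (leviCivitaₗ f x w v) := rfl

/-- The covariant derivative `∇B` at a point as a trilinear map. -/
noncomputable def covDerivBₗ (hf : ContDiffAt ℝ ∞ f x) (he : IsOrthonormalFrame f x e) :
    EuclideanSpace ℝ (Fin n) →ₗ[ℝ] EuclideanSpace ℝ (Fin n) →ₗ[ℝ]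
      EuclideanSpace ℝ (Fin n) →ₗ[ℝ] EuclideanSpace ℝ (Fin N) where
  toFun w := LinearMap.mk₂ ℝ (covDerivB f x w)
    (fun _ _ _ => by
      simp only [covDerivB_eq hf he, map_add, LinearMap.add_apply]; abel)
    (fun _ _ _ => by
      simp only [covDerivB_eq hf he, map_smul, LinearMap.smul_apply, smul_sub])
    (fun _ _ _ => by
      simp only [covDerivB_eq hf he, map_add]; abel)
    (fun _ _ _ => by
      simp only [covDerivB_eq hf he, map_smul, smul_sub])
  map_add' w w' := by
    refine LinearMap.ext₂ fun u v => ?_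
    simp only [LinearMap.mk₂_apply, LinearMap.add_apply, covDerivB_eq hf he, map_add, dirDerivB]
    abel
  map_smul' c w := by
    refine LinearMap.ext₂ fun u v => ?_
    simp only [LinearMap.mk₂_apply, LinearMap.smul_apply, covDerivB_eq hf he, map_smul, dirDerivB,
      smul_sub, RingHom.id_apply]

@[simp]
lemma covDerivBₗ_apply (hf : ContDiffAt ℝ ∞ f x) (he : IsOrthonormalFrame f x e)
    (w u v : EuclideanSpace ℝ (Fin n)) : covDerivBₗ hf he w u v = covDerivB f x w u v := rfl

/-- `∇B` in terms of third derivatives: modulo tangential terms, `(∇_w B)_{u v}` is `D³f(w, u, v)`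
corrected by three Christoffel terms. The right-hand side is symmetric in `w`, `u`, `v`. -/
lemma covDerivB_eq_thirdDeriv (hf : ContDiffAt ℝ ∞ f x) (he : IsOrthonormalFrame f x e)
    (w u v : EuclideanSpace ℝ (Fin n)) :
    covDerivB f x w u v = normalPart f x (fderiv ℝ (fderiv ℝ (fderiv ℝ f)) x w u v)
      - secondFundForm f x w (leviCivita f x u v)
      - secondFundForm f x (leviCivita f x w u) v
      - secondFundForm f x u (leviCivita f x w v) := by
  have h1 : ContDiffAt ℝ ∞ (fderiv ℝ f) x := hf.fderiv_right (m := ∞) (by simp)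
  have h2 : ContDiffAt ℝ ∞ (fderiv ℝ (fderiv ℝ f)) x := h1.fderiv_right (m := ∞) (by simp)
  have hd1 := (h1.differentiableAt (by simp)).hasFDerivAt
  have hd2 := (h2.differentiableAt (by simp)).hasFDerivAt
  have hdT := ((contDiffAt_leviCivita hf he u v).differentiableAt (by simp)).hasFDerivAt
  have hD : HasFDerivAt (fun y => secondFundForm f y u v) _ x :=
    ((hd2.clm_apply (hasFDerivAt_const u x)).clm_apply (hasFDerivAt_const v x)).sub
      (hd1.clm_apply hdT)
  have hval : fderiv ℝ (fun y => secondFundForm f y u v) x w =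
      fderiv ℝ (fderiv ℝ (fderiv ℝ f)) x w u v
        - (fderiv ℝ f x (fderiv ℝ (fun y => leviCivita f y u v) x w)
          + secondDeriv f x w (leviCivita f x u v)) := by
    rw [hD.fderiv]
    simp [secondDeriv, leviCivita]
  rw [covDerivB, hval, normalPart_sub, normalPart_add, normalPart_fderiv he, zero_add]
  rfl

/-- The Codazzi equation. -/
lemma covDerivB_comm_left (hf : ContDiffAt ℝ ∞ f x) (he : IsOrthonormalFrame f x e)
    (w u v : EuclideanSpace ℝ (Fin n)) : covDerivB f x w u v = covDerivB f x u w v := by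
  have h1 : ContDiffAt ℝ ∞ (fderiv ℝ f) x := hf.fderiv_right (m := ∞) (by simp)
  rw [covDerivB_eq_thirdDeriv hf he, covDerivB_eq_thirdDeriv hf he u w v,
    (h1.isSymmSndFDerivAt minSmoothness_two_le_infty).eq w u, leviCivita_comm hf w u]
  abel

lemma covDerivB_comm_right (hf : ContDiffAt ℝ ∞ f x)
    (w u v : EuclideanSpace ℝ (Fin n)) : covDerivB f x w u v = covDerivB f x w v u := by
  have h : (fun y => secondFundForm f y u v) =ᶠ[nhds x] fun y => secondFundForm f y v u := by
    have h2 : ContDiffAt ℝ 2 f x := hf.of_le (by simpa using minSmoothness_two_le_infty)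
    filter_upwards [h2.eventually (by simp)] with y hy
    rw [secondFundForm, secondFundForm, secondDeriv, secondDeriv,
      (hy.isSymmSndFDerivAt (by simp)).eq u v]
  rw [covDerivB, covDerivB, h.fderiv_eq, secondFundForm_comm hf _ v, secondFundForm_comm hf u _]
  abel

end CovDeriv

/-! ### Traces and their derivatives -/

section Trace

variable {f : EuclideanSpace ℝ (Fin n) → EuclideanSpace ℝ (Fin N)} {x : EuclideanSpace ℝ (Fin n)}
  {e : Fin n → EuclideanSpace ℝ (Fin n)}

lemma metric_symm (f : EuclideanSpace ℝ (Fin n) → EuclideanSpace ℝ (Fin N))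
    (x u v : EuclideanSpace ℝ (Fin n)) : metric f x u v = metric f x v u :=
  real_inner_comm _ _

lemma metric_sum_smul_left {ι : Type*} (s : Finset ι) (c : ι → ℝ)
    (u : ι → EuclideanSpace ℝ (Fin n)) (v : EuclideanSpace ℝ (Fin n)) :
    metric f x (∑ i ∈ s, c i • u i) v = ∑ i ∈ s, c i * metric f x (u i) v := by
  simp [metric, sum_inner, real_inner_smul_left]

/-- The metric is parallel: `∂_w g(u, v) = g(∇_w u, v) + g(u, ∇_w v)`. -/
lemma fderiv_metric (hf : ContDiffAt ℝ ∞ f x) (he : IsOrthonormalFrame f x e)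
    (w u v : EuclideanSpace ℝ (Fin n)) :
    fderiv ℝ (fun y => metric f y u v) x w
      = metric f x (leviCivita f x w u) v + metric f x u (leviCivita f x w v) := by
  have h1 : DifferentiableAt ℝ (fderiv ℝ f) x :=
    (hf.fderiv_right (m := ∞) (by simp)).differentiableAt (by simp)
  have hd : ∀ u, HasFDerivAt (fun y => fderiv ℝ f y u) ((fderiv ℝ (fderiv ℝ f) x).flip u) x :=
    fun u => by simpa using h1.hasFDerivAt.clm_apply (hasFDerivAt_const u x)
  have h := ((hd u).inner ℝ (hd v)).fderiv
  unfold metric at *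
  rw [h]
  have h2 : ∀ u v, ⟪fderiv ℝ f x (leviCivita f x w u), fderiv ℝ f x v⟫
      = ⟪secondDeriv f x w u, fderiv ℝ f x v⟫ := fun u v =>
    metric_tangentialPart he _ _
  rw [h2, real_inner_comm (fderiv ℝ f x (leviCivita f x w v)), h2]
  simp [secondDeriv, fderivInnerCLM_apply, real_inner_comm, add_comm]

/-- The derivative of the inverse metric: `∂_w g^{ij} = -∑ₖ ((∇_w eₖ)ⁱ eₖʲ + eₖⁱ (∇_w eₖ)ʲ)`. -/
lemma fderiv_invMetric (hf : ContDiffAt ℝ ∞ f x) (he : IsOrthonormalFrame f x e)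
    (w : EuclideanSpace ℝ (Fin n)) (i j : Fin n) :
    fderiv ℝ (fun y => invMetric f y i j) x w
      = -∑ k, (leviCivita f x w (e k) i * e k j + e k i * leviCivita f x w (e k) j) := by
  set D : Fin n → ℝ := fun b => fderiv ℝ (fun y => invMetric f y i b) x w with hD
  -- Differentiate `∑ b, g^{ib} g_{bc} = δ_{ic}`.
  have hrel : ∀ c, ∑ b, D b * metric f x (basisVec b) (basisVec c) =
      -∑ b, invMetric f x i b * (metric f x (leviCivita f x w (basisVec b)) (basisVec c)
        + metric f x (basisVec b) (leviCivita f x w (basisVec c))) := by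
    intro c
    have hdi : ∀ b, DifferentiableAt ℝ (fun y => invMetric f y i b) x := fun b =>
      (contDiffAt_invMetric hf he i b).differentiableAt (by simp)
    have hdm : ∀ b, DifferentiableAt ℝ (fun y => metric f y (basisVec b) (basisVec c)) x :=
      fun b => (contDiffAt_metric hf _ _).differentiableAt (by simp)
    have hev : (fun y => ∑ b, invMetric f y i b * metric f y (basisVec b) (basisVec c))
        =ᶠ[nhds x] fun _ => (1 : Matrix (Fin n) (Fin n) ℝ) i c := by
      have hcont : ContinuousAt (fun y => (metricMatrix f y).det) x :=
        (contDiffAt_det fun i j => contDiffAt_metric hf _ _).continuousAt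
      filter_upwards [hcont.eventually_ne (det_metricMatrix_ne_zero he)] with y hy
      rw [← Matrix.nonsing_inv_mul (metricMatrix f y) (isUnit_iff_ne_zero.mpr hy),
        Matrix.mul_apply]
      rfl
    have h0 := hev.fderiv_eq (𝕜 := ℝ)
    rw [fderiv_fun_sum fun b _ => (hdi b).fun_mul (hdm b)] at h0
    have h1 := congrArg (fun L => L w) h0
    simp only [fderiv_fun_mul (hdi _) (hdm _), fderiv_fun_const, Pi.zero_apply,
      sum_apply, add_apply,
      smul_apply, zero_apply, smul_eq_mul,
      Finset.sum_add_distrib, fderiv_metric hf he] at h1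
    rw [add_comm] at h1
    rw [eq_neg_iff_add_eq_zero, ← h1]
    congr 1
    refine Finset.sum_congr rfl fun b _ => mul_comm _ _
  have htr : ∀ φ : EuclideanSpace ℝ (Fin n) →ₗ[ℝ] ℝ,
      ∑ b, invMetric f x i b * φ (basisVec b) = ∑ k, e k i * φ (e k) := by
    intro φ
    have h : ∀ k, φ (e k) = ∑ b, e k b * φ (basisVec b) := fun k => by
      conv_lhs => rw [← sum_smul_basisVec (e k)]
      simp
    simp only [h, invMetric_eq_sum he, Finset.sum_mul, Finset.mul_sum]
    rw [Finset.sum_comm]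
    simp only [mul_assoc]
  have hmet : ∀ v, metric f x (∑ b, D b • basisVec b) v =
      -∑ k, e k i * (metric f x (leviCivita f x w (e k)) v
        + metric f x (e k) (leviCivita f x w v)) := by
    intro v
    let φ : EuclideanSpace ℝ (Fin n) →ₗ[ℝ] ℝ :=
      { toFun := fun u => metric f x (leviCivitaₗ f x w u) v
          + metric f x u (leviCivitaₗ f x w v)
        map_add' := fun _ _ => by simp only [metric, map_add, inner_add_left]; ring
        map_smul' := fun _ _ => by
          simp only [metric, map_smul, real_inner_smul_left, smul_eq_mul, RingHom.id_apply]; ring }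
    refine Eq.trans ?_ (congrArg Neg.neg (htr φ))
    let ψ₁ : EuclideanSpace ℝ (Fin n) →ₗ[ℝ] ℝ :=
      { toFun := fun v => metric f x (∑ b, D b • basisVec b) v
        map_add' := fun _ _ => by simp only [metric, map_add, inner_add_right]
        map_smul' := fun _ _ => by
          simp only [metric, map_smul, real_inner_smul_right, smul_eq_mul, RingHom.id_apply] }
    let ψ₂ : EuclideanSpace ℝ (Fin n) →ₗ[ℝ] ℝ :=
      { toFun := fun v => -∑ b, invMetric f x i b *
          (metric f x (leviCivitaₗ f x w (basisVec b)) v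
            + metric f x (basisVec b) (leviCivitaₗ f x w v))
        map_add' := fun _ _ => by
          rw [← neg_add, ← Finset.sum_add_distrib]
          simp only [metric, map_add, inner_add_right]
          congr 1
          exact Finset.sum_congr rfl fun _ _ => by ring
        map_smul' := fun _ _ => by
          simp only [metric, map_smul, real_inner_smul_right, smul_eq_mul, RingHom.id_apply,
            mul_neg, Finset.mul_sum]
          congr 1
          exact Finset.sum_congr rfl fun _ _ => by ring }
    have hψ : ψ₁ = ψ₂ := by
      refine LinearMap.ext fun v => ?_
      rw [← sum_smul_basisVec v]
      simp only [map_sum, map_smul]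
      refine Finset.sum_congr rfl fun c _ => ?_
      congr 1
      change metric f x (∑ b, D b • basisVec b) (basisVec c) = _
      rw [metric_sum_smul_left, hrel]
      rfl
    exact congrArg (fun L => L v) hψ
  have hvec := sum_metric_smul he (∑ b, D b • basisVec b)
  simp only [hmet] at hvec
  have hsplit : ∑ b, D b • basisVec b = -(∑ k, e k i • leviCivita f x w (e k)
      + ∑ l, (leviCivita f x w (e l) i) • e l) := by
    rw [← hvec]
    simp only [neg_smul, Finset.sum_neg_distrib, mul_add, Finset.sum_add_distrib, add_smul]
    congr 2
    · simp only [Finset.sum_smul, mul_smul]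
      rw [Finset.sum_comm]
      refine Finset.sum_congr rfl fun k _ => ?_
      rw [← Finset.smul_sum, sum_metric_smul he]
    · refine Finset.sum_congr rfl fun l _ => ?_
      congr 1
      have := congrArg (fun u : EuclideanSpace ℝ (Fin n) => u i)
        (sum_metric_smul he (leviCivita f x w (e l)))
      rw [← this]
      simp only [WithLp.ofLp_sum, Finset.sum_apply, WithLp.ofLp_smul, Pi.smul_apply, smul_eq_mul]
      exact Finset.sum_congr rfl fun k _ => by rw [metric_symm, mul_comm]
  have hj := congrArg (fun u : EuclideanSpace ℝ (Fin n) => u j) hsplit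
  have hl : (∑ b, D b • basisVec b : EuclideanSpace ℝ (Fin n)) j = D j :=
    congrArg (fun u : EuclideanSpace ℝ (Fin n) => u j)
      (sum_smul_basisVec (WithLp.toLp 2 D : EuclideanSpace ℝ (Fin n)))
  simp only [hl] at hj
  change D j = _
  rw [hj]
  simp only [WithLp.ofLp_neg, WithLp.ofLp_add, WithLp.ofLp_sum, Finset.sum_apply,
    WithLp.ofLp_smul, Pi.smul_apply, smul_eq_mul, Pi.neg_apply, Pi.add_apply,
    Finset.sum_add_distrib]
  ring

/-- Covariant differentiation commutes with traces. Here `Q` is a field of bilinear maps whose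
components have directional derivatives `Q'` along `w`. -/
lemma fderiv_trace {W : Type*} [NormedAddCommGroup W] [NormedSpace ℝ W]
    (hf : ContDiffAt ℝ ∞ f x) (he : IsOrthonormalFrame f x e) (w : EuclideanSpace ℝ (Fin n))
    (Q : EuclideanSpace ℝ (Fin n) →
      EuclideanSpace ℝ (Fin n) →ₗ[ℝ] EuclideanSpace ℝ (Fin n) →ₗ[ℝ] W)
    (Q' : EuclideanSpace ℝ (Fin n) →ₗ[ℝ] EuclideanSpace ℝ (Fin n) →ₗ[ℝ] W)
    (hQ : ∀ u v, DifferentiableAt ℝ (fun y => Q y u v) x)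
    (hQ' : ∀ u v, fderiv ℝ (fun y => Q y u v) x w = Q' u v) :
    fderiv ℝ (fun y => ∑ i, ∑ j, invMetric f y i j • Q y (basisVec i) (basisVec j)) x w
      = ∑ k, (Q' (e k) (e k) - Q x (leviCivita f x w (e k)) (e k)
          - Q x (e k) (leviCivita f x w (e k))) := by
  have hdi : ∀ i j, DifferentiableAt ℝ (fun y => invMetric f y i j) x := fun i j =>
    (contDiffAt_invMetric hf he i j).differentiableAt (by simp)
  rw [fderiv_fun_sum fun i _ => DifferentiableAt.fun_sum fun j _ => (hdi i j).fun_smul (hQ _ _)]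
  have h1 : ∀ i, fderiv ℝ (fun y => ∑ j, invMetric f y i j • Q y (basisVec i) (basisVec j)) x
      = ∑ j, fderiv ℝ (fun y => invMetric f y i j • Q y (basisVec i) (basisVec j)) x := fun i =>
    fderiv_fun_sum fun j _ => (hdi i j).fun_smul (hQ _ _)
  simp only [h1, fderiv_fun_smul (hdi _ _) (hQ _ _), sum_apply,
    add_apply, smul_apply,
    ContinuousLinearMap.smulRight_apply, hQ', fderiv_invMetric hf he, Finset.sum_add_distrib,
    sum_invMetric_smul he Q', Finset.sum_sub_distrib]
  have h2 : ∑ i, ∑ j, (-(∑ k, leviCivita f x w (e k) i * e k j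
      + ∑ k, e k i * leviCivita f x w (e k) j)) • Q x (basisVec i) (basisVec j)
      = -(∑ k, Q x (leviCivita f x w (e k)) (e k) + ∑ k, Q x (e k) (leviCivita f x w (e k))) := by
    have hs : ∀ u v : Fin n → EuclideanSpace ℝ (Fin n),
        ∑ i, ∑ j, (∑ k, u k i * v k j) • Q x (basisVec i) (basisVec j)
          = ∑ k, Q x (u k) (v k) := by
      intro u v
      simp only [Finset.sum_smul, ← sum_mul_smul_basisVec (Q x) (u _) (v _)]
      calc _ = ∑ i, ∑ k, ∑ j, (u k i * v k j) • Q x (basisVec i) (basisVec j) :=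
            Finset.sum_congr rfl fun i _ => Finset.sum_comm
        _ = _ := Finset.sum_comm
    rw [← hs (fun k => leviCivita f x w (e k)) e, ← hs e fun k => leviCivita f x w (e k)]
    simp only [neg_smul, add_smul, Finset.sum_neg_distrib, Finset.sum_add_distrib]
  rw [h2]
  abel

end Trace

/-! ### The invariants of `B` and `∇B` in an orthonormal frame -/

section Invariants

variable {f : EuclideanSpace ℝ (Fin n) → EuclideanSpace ℝ (Fin N)} {x : EuclideanSpace ℝ (Fin n)}
  {e : Fin n → EuclideanSpace ℝ (Fin n)}

lemma normSqB_eq_trace (f : EuclideanSpace ℝ (Fin n) → EuclideanSpace ℝ (Fin N))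
    (x : EuclideanSpace ℝ (Fin n)) :
    normSqB f x = ∑ i, ∑ k, invMetric f x i k • ∑ j, ∑ l, invMetric f x j l •
      ⟪secondFundForm f x (basisVec i) (basisVec j),
        secondFundForm f x (basisVec k) (basisVec l)⟫ := by
  simp only [normSqB, smul_eq_mul, Finset.mul_sum, mul_assoc]
  exact Finset.sum_congr rfl fun i _ => Finset.sum_comm

/-- The contraction `∑_{jl} g^{jl} ⟨B_{uj}, B_{vl}⟩` in an orthonormal frame. -/
lemma sum_invMetric_inner_secondFundForm (he : IsOrthonormalFrame f x e)
    (u v : EuclideanSpace ℝ (Fin n)) :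
    ∑ j, ∑ l, invMetric f x j l •
      ⟪secondFundForm f x u (basisVec j), secondFundForm f x v (basisVec l)⟫
      = ∑ m, ⟪secondFundForm f x u (e m), secondFundForm f x v (e m)⟫ :=
  sum_invMetric_smul he ((innerₗ (EuclideanSpace ℝ (Fin N))).compl₁₂
    (secondFundFormₗ f x u) (secondFundFormₗ f x v))

lemma normSqB_eq_sum (he : IsOrthonormalFrame f x e) :
    normSqB f x = ∑ k, ∑ l, ⟪secondFundForm f x (e k) (e l), secondFundForm f x (e k) (e l)⟫ := by
  have h := sum_invMetric_smul he (∑ m, (innerₗ (EuclideanSpace ℝ (Fin N))).compl₁₂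
    ((secondFundFormₗ f x).flip (e m)) ((secondFundFormₗ f x).flip (e m)))
  simp only [LinearMap.sum_apply, LinearMap.compl₁₂_apply, LinearMap.flip_apply,
    secondFundFormₗ_apply, innerₗ_apply_apply] at h
  rw [normSqB_eq_trace, ← h]
  simp only [sum_invMetric_inner_secondFundForm he]

lemma normSqGrad_eq_sum (he : IsOrthonormalFrame f x e) (h : EuclideanSpace ℝ (Fin n) → ℝ) :
    normSqGrad f h x = ∑ k, fderiv ℝ h x (e k) ^ 2 := by
  have := sum_invMetric_smul he ((LinearMap.mul ℝ ℝ).compl₁₂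
    (fderiv ℝ h x).toLinearMap (fderiv ℝ h x).toLinearMap)
  simpa [normSqGrad, sq] using this

lemma normSqCovDerivB_eq_sum (hf : ContDiffAt ℝ ∞ f x) (he : IsOrthonormalFrame f x e) :
    normSqCovDerivB f x = ∑ p, ∑ q, ∑ r,
      ⟪covDerivB f x (e p) (e q) (e r), covDerivB f x (e p) (e q) (e r)⟫ := by
  set T := covDerivBₗ hf he with hT
  let I := innerₗ (EuclideanSpace ℝ (Fin N))
  have h1 : ∀ a b i j, ∑ c, ∑ k, invMetric f x c k •
      ⟪T (basisVec a) (basisVec b) (basisVec c), T (basisVec i) (basisVec j) (basisVec k)⟫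
      = ∑ r, ⟪T (basisVec a) (basisVec b) (e r), T (basisVec i) (basisVec j) (e r)⟫ :=
    fun a b i j => sum_invMetric_smul he
      (I.compl₁₂ (T (basisVec a) (basisVec b)) (T (basisVec i) (basisVec j)))
  have h2 : ∀ a i, ∑ b, ∑ j, invMetric f x b j •
      ∑ r, ⟪T (basisVec a) (basisVec b) (e r), T (basisVec i) (basisVec j) (e r)⟫
      = ∑ q, ∑ r, ⟪T (basisVec a) (e q) (e r), T (basisVec i) (e q) (e r)⟫ := fun a i => by
    have := sum_invMetric_smul he
      (∑ r, I.compl₁₂ ((T (basisVec a)).flip (e r)) ((T (basisVec i)).flip (e r)))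
    simpa [I, LinearMap.sum_apply, LinearMap.compl₁₂_apply, LinearMap.flip_apply] using this
  have h3 : ∑ a, ∑ i, invMetric f x a i •
      ∑ q, ∑ r, ⟪T (basisVec a) (e q) (e r), T (basisVec i) (e q) (e r)⟫
      = ∑ p, ∑ q, ∑ r, ⟪T (e p) (e q) (e r), T (e p) (e q) (e r)⟫ := by
    have := sum_invMetric_smul he
      (∑ q, ∑ r, I.compl₁₂ ((T.flip (e q)).flip (e r)) ((T.flip (e q)).flip (e r)))
    simpa [I, LinearMap.sum_apply, LinearMap.compl₁₂_apply, LinearMap.flip_apply] using this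
  have hperm : ∀ G : Fin n → Fin n → Fin n → Fin n → Fin n → ℝ,
      ∑ b, ∑ c, ∑ i, ∑ j, ∑ k, G b c i j k = ∑ i, ∑ b, ∑ j, ∑ c, ∑ k, G b c i j k := by
    intro G
    calc _ = ∑ b, ∑ i, ∑ c, ∑ j, ∑ k, G b c i j k :=
          Finset.sum_congr rfl fun b _ => Finset.sum_comm
      _ = ∑ i, ∑ b, ∑ c, ∑ j, ∑ k, G b c i j k := Finset.sum_comm
      _ = _ := Finset.sum_congr rfl fun i _ => Finset.sum_congr rfl fun b _ => Finset.sum_comm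
  simp only [hT, covDerivBₗ_apply] at h1 h2 h3
  rw [← h3]
  simp only [← h2, ← h1, smul_eq_mul, Finset.mul_sum]
  refine Finset.sum_congr rfl fun a _ => (hperm _).trans ?_
  simp only [mul_assoc]

/-- The derivative of `|B|²` is `2 ⟨B, ∇B⟩`. -/
lemma fderiv_normSqB (hf : ContDiffAt ℝ ∞ f x) (he : IsOrthonormalFrame f x e)
    (w : EuclideanSpace ℝ (Fin n)) :
    fderiv ℝ (normSqB f) x w = 2 * ∑ k, ∑ l,
      ⟪secondFundForm f x (e k) (e l), covDerivB f x w (e k) (e l)⟫ := by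
  let I := innerₗ (EuclideanSpace ℝ (Fin N))
  let B := secondFundFormₗ f
  let Γ := leviCivitaₗ f x w
  set dB := dirDerivB hf he w with hdB
  let Q : EuclideanSpace ℝ (Fin n) →
      EuclideanSpace ℝ (Fin n) →ₗ[ℝ] EuclideanSpace ℝ (Fin n) →ₗ[ℝ] ℝ := fun y =>
    ∑ j, ∑ l, invMetric f y j l • I.compl₁₂ ((B y).flip (basisVec j)) ((B y).flip (basisVec l))
  let Q' : EuclideanSpace ℝ (Fin n) →ₗ[ℝ] EuclideanSpace ℝ (Fin n) →ₗ[ℝ] ℝ := ∑ m,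
    (I.compl₁₂ (dB.flip (e m)) ((B x).flip (e m)) + I.compl₁₂ ((B x).flip (e m)) (dB.flip (e m))
      - I.compl₁₂ ((B x).flip (Γ (e m))) ((B x).flip (e m))
      - I.compl₁₂ ((B x).flip (e m)) ((B x).flip (Γ (e m))))
  have hQapp : ∀ y u v, Q y u v = ∑ j, ∑ l, invMetric f y j l •
      ⟪secondFundForm f y u (basisVec j), secondFundForm f y v (basisVec l)⟫ := fun y u v => by
    simp [Q, I, B, LinearMap.sum_apply, LinearMap.smul_apply, LinearMap.compl₁₂_apply,
      LinearMap.flip_apply]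
  have hdiff := differentiableAt_secondFundForm hf he
  have hQ : ∀ u v, DifferentiableAt ℝ (fun y => Q y u v) x := fun u v => by
    simp only [hQapp]
    refine DifferentiableAt.fun_sum fun j _ => DifferentiableAt.fun_sum fun l _ => ?_
    exact ((contDiffAt_invMetric hf he j l).differentiableAt (by simp)).fun_smul
      ((hdiff u _).inner ℝ (hdiff v _))
  have hQ' : ∀ u v, fderiv ℝ (fun y => Q y u v) x w = Q' u v := fun u v => by
    simp only [hQapp]
    have h := fderiv_trace hf he w (fun y => I.compl₁₂ (B y u) (B y v))
      (I.compl₁₂ (dB u) (B x v) + I.compl₁₂ (B x u) (dB v))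
      (fun a b => (hdiff u a).inner ℝ (hdiff v b))
      (fun a b => by
        change fderiv ℝ (fun y => ⟪secondFundForm f y u a, secondFundForm f y v b⟫) x w
          = ⟪fderiv ℝ (fun y => secondFundForm f y u a) x w, secondFundForm f x v b⟫
            + ⟪secondFundForm f x u a, fderiv ℝ (fun y => secondFundForm f y v b) x w⟫
        rw [fderiv_inner_apply ℝ (hdiff u a) (hdiff v b), add_comm])
    refine h.trans ?_
    simp [Q', I, B, Γ, LinearMap.sum_apply, LinearMap.add_apply, LinearMap.sub_apply,
      LinearMap.compl₁₂_apply, LinearMap.flip_apply]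
  have hmain := fderiv_trace hf he w Q Q' hQ hQ'
  have hN : normSqB f = fun y => ∑ i, ∑ j, invMetric f y i j • Q y (basisVec i) (basisVec j) := by
    funext y
    rw [normSqB_eq_trace]
    simp only [hQapp]
  rw [hN, hmain, Finset.mul_sum]
  refine Finset.sum_congr rfl fun k _ => ?_
  simp only [hQapp, sum_invMetric_inner_secondFundForm he, Q', LinearMap.sum_apply,
    LinearMap.add_apply, LinearMap.sub_apply, LinearMap.compl₁₂_apply, LinearMap.flip_apply,
    ← Finset.sum_sub_distrib, Finset.mul_sum]
  refine Finset.sum_congr rfl fun m _ => ?_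
  rw [covDerivB_eq hf he, inner_sub_right, inner_sub_right, normalPartₗ_apply,
    inner_normalPart_right (inner_secondFundForm_fderiv he _ _)]
  simp only [I, B, Γ, innerₗ_apply_apply, secondFundFormₗ_apply, leviCivitaₗ_apply, ← hdB]
  rw [real_inner_comm (secondFundForm f x (e k) (e m)) (dB (e k) (e m)),
    real_inner_comm (secondFundForm f x (e k) (e m))
      (secondFundForm f x (e k) (leviCivita f x w (e m))),
    real_inner_comm (secondFundForm f x (e k) (e m))
      (secondFundForm f x (leviCivita f x w (e k)) (e m))]
  ring

lemma meanCurvature_eq_sum (he : IsOrthonormalFrame f x e) :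
    meanCurvature f x = ∑ k, secondFundForm f x (e k) (e k) :=
  sum_invMetric_smul he (secondFundFormₗ f x)

/-- On a minimal submanifold `∇B` is trace free in its last two arguments. -/
lemma sum_covDerivB_eq_zero (hf : ContDiffAt ℝ ∞ f x) (he : IsOrthonormalFrame f x e)
    (hH : ∀ᶠ y in nhds x, meanCurvature f y = 0) (w : EuclideanSpace ℝ (Fin n)) :
    ∑ k, covDerivB f x w (e k) (e k) = 0 := by
  have h := fderiv_trace hf he w (secondFundFormₗ f) (dirDerivB hf he w)
    (differentiableAt_secondFundForm hf he) (fun _ _ => rfl)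
  have h0 : fderiv ℝ (meanCurvature f) x = 0 := by
    have : meanCurvature f =ᶠ[nhds x] fun _ => 0 := hH
    rw [this.fderiv_eq]
    simp
  have h1 : fderiv ℝ (fun y => ∑ i, ∑ j, invMetric f y i j •
      secondFundFormₗ f y (basisVec i) (basisVec j)) x w = 0 := by
    change fderiv ℝ (meanCurvature f) x w = 0
    rw [h0]; rfl
  rw [h1] at h
  have h2 := congrArg (normalPartₗ f x) h
  rw [map_zero, map_sum] at h2
  rw [h2]
  refine Finset.sum_congr rfl fun k _ => ?_
  simp only [covDerivB_eq hf he, map_sub, normalPartₗ_apply, secondFundFormₗ_apply,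
    normalPart_secondFundForm he, leviCivitaₗ_apply]

end Invariants

/-! ### The differential of the Gauss map -/

section Gauss

variable {f : EuclideanSpace ℝ (Fin n) → EuclideanSpace ℝ (Fin N)} {x : EuclideanSpace ℝ (Fin n)}
  {e : Fin n → EuclideanSpace ℝ (Fin n)}

/-- Where row `r` of a matrix function vanishes, only that row contributes to the derivative of
the determinant. -/
lemma fderiv_det_of_row_eq_zero {E : Type*} [NormedAddCommGroup E] [NormedSpace ℝ E] {k : ℕ}
    {x : E} {A : E → Matrix (Fin k) (Fin k) ℝ}
    (hA : ∀ i j, ContDiffAt ℝ ∞ (fun y => A y i j) x) (r : Fin k) (hr : ∀ j, A x r j = 0) (w : E) :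
    fderiv ℝ (fun y => (A y).det) x w
      = ((A x).updateRow r fun j => fderiv ℝ (fun y => A y r j) x w).det := by
  have hadj : ∀ j, DifferentiableAt ℝ (fun y => (A y).adjugate j r) x := fun j => by
    simp only [Matrix.adjugate_apply]
    refine (contDiffAt_det fun a b => ?_).differentiableAt (by simp)
    simp only [Matrix.updateRow_apply]
    split_ifs
    · exact contDiffAt_const
    · exact hA _ _
  have hent : ∀ j, DifferentiableAt ℝ (fun y => A y r j) x := fun j =>
    (hA r j).differentiableAt (by simp)
  have h1 : (fun y => (A y).det) = fun y => ∑ j, A y r j * (A y).adjugate j r :=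
    funext fun y => Matrix.det_eq_sum_mul_adjugate_row (A y) r
  rw [h1, fderiv_fun_sum fun j _ => (hent j).fun_mul (hadj j),
    Matrix.det_eq_sum_mul_adjugate_row _ r]
  rw [sum_apply]
  refine Finset.sum_congr rfl fun j _ => ?_
  rw [fderiv_fun_mul (hent _) (hadj _)]
  simp only [add_apply, smul_apply, smul_eq_mul, hr, zero_mul, zero_add, Matrix.updateRow_self,
    Matrix.adjugate_apply, Matrix.updateRow_idem]
  exact mul_comm _ _

lemma det_metricMatrix_pos (he : IsOrthonormalFrame f x e) : 0 < (metricMatrix f x).det := by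
  have h := congrArg Matrix.det (metricMatrix_mul_eq_one he)
  rw [Matrix.det_mul, Matrix.det_mul, Matrix.det_transpose, Matrix.det_one] at h
  by_contra hneg
  nlinarith [mul_self_nonneg (Matrix.of fun k i => e k i).det]

lemma gaussMap_apply (f : EuclideanSpace ℝ (Fin n) → EuclideanSpace ℝ (Fin N))
    (y : EuclideanSpace ℝ (Fin n)) (v : Fin n → EuclideanSpace ℝ (Fin N)) :
    gaussMap f y v = (√(metricMatrix f y).det)⁻¹ *
      (Matrix.of fun j i => ⟪fderiv ℝ f y (basisVec i), v j⟫).det := rfl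

/-- The Gauss map is differentiable, so that `gaussRank` is the rank of a genuine differential and
not of the junk value `0`. -/
lemma differentiableAt_gaussMap (hf : ContDiffAt ℝ ∞ f x) (he : IsOrthonormalFrame f x e) :
    DifferentiableAt ℝ (gaussMap f) x := by
  have hdet : DifferentiableAt ℝ (fun y => (√(metricMatrix f y).det)⁻¹) x := by
    have h : DifferentiableAt ℝ (fun y => (metricMatrix f y).det) x :=
      (contDiffAt_det fun i j => contDiffAt_metric hf _ _).differentiableAt (by simp)
    exact (h.sqrt (det_metricMatrix_pos he).ne').fun_inv
      (Real.sqrt_pos.mpr (det_metricMatrix_pos he)).ne'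
  have hpi : DifferentiableAt ℝ (fun y => ContinuousLinearMap.pi fun i =>
      innerSL ℝ (fderiv ℝ f y (basisVec i))) x := by
    let J : EuclideanSpace ℝ (Fin N) →L[ℝ] EuclideanSpace ℝ (Fin N) →L[ℝ] ℝ :=
      (isBoundedBilinearMap_inner (𝕜 := ℝ)).toContinuousLinearMap
    have h : (fun y => ContinuousLinearMap.pi fun i => innerSL ℝ (fderiv ℝ f y (basisVec i)))
        = fun y => ∑ i, (ContinuousLinearMap.single ℝ (fun _ : Fin n => ℝ) i).comp
          (J (fderiv ℝ f y (basisVec i))) := by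
      funext y
      ext v i
      simp only [ContinuousLinearMap.pi_apply, innerSL_apply_apply, sum_apply, Finset.sum_apply]
      simp [Pi.single_apply, J]
    rw [h]
    refine DifferentiableAt.fun_sum fun i _ => (differentiableAt_const _).clm_comp ?_
    exact J.differentiableAt.comp x ((contDiffAt_fderiv_apply hf _).differentiableAt (by simp))
  exact hdet.fun_smul
    (HasFDerivAt.continuousAlternatingMapCompContinuousLinearMap
      (hasFDerivAt_const (detForm n) x) hpi.hasFDerivAt).differentiableAt

/-- Directions in which the Gauss map is stationary lie in the relative nullity of `B`. The
differential of the Gauss map is tested on the `n`-vectors obtained from `∂₁f ∧ ⋯ ∧ ∂ₙf` by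
replacing one factor by a normal vector. -/
lemma secondFundForm_eq_zero_of_fderiv_gaussMap_eq_zero (hf : ContDiffAt ℝ ∞ f x)
    (he : IsOrthonormalFrame f x e) {w : EuclideanSpace ℝ (Fin n)}
    (hw : fderiv ℝ (gaussMap f) x w = 0) (u : EuclideanSpace ℝ (Fin n)) :
    secondFundForm f x w u = 0 := by
  have hsfd : ∀ i, fderiv ℝ (fun y => fderiv ℝ f y (basisVec i)) x w
      = secondDeriv f x w (basisVec i) := fun i => by
    have h1 : DifferentiableAt ℝ (fderiv ℝ f) x :=
      (hf.fderiv_right (m := ∞) (by simp)).differentiableAt (by simp)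
    rw [(h1.hasFDerivAt.clm_apply (hasFDerivAt_const (basisVec i) x)).fderiv]
    simp [secondDeriv]
  have key : ∀ ξ : EuclideanSpace ℝ (Fin N), (∀ z, ⟪ξ, fderiv ℝ f x z⟫ = 0) →
      ∀ i, ⟪secondDeriv f x w (basisVec i), ξ⟫ = 0 := by
    intro ξ hξ
    set d : Fin n → ℝ := fun i => ⟪secondDeriv f x w (basisVec i), ξ⟫ with hd
    have hdet : ∀ k, ((metricMatrix f x).updateRow k d).det = 0 := by
      intro k
      -- Row `k` of the Gram matrix below vanishes at `x`, and its derivative along `w` is `d`.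
      let v : Fin n → EuclideanSpace ℝ (Fin N) :=
        Function.update (fun j => fderiv ℝ f x (basisVec j)) k ξ
      let A : EuclideanSpace ℝ (Fin n) → Matrix (Fin n) (Fin n) ℝ := fun y =>
        Matrix.of fun j i => ⟪fderiv ℝ f y (basisVec i), v j⟫
      have hA : ∀ i j, ContDiffAt ℝ ∞ (fun y => A y i j) x := fun i j =>
        (contDiffAt_fderiv_apply hf _).inner ℝ contDiffAt_const
      have hk : ∀ j, A x k j = 0 := fun j => by
        simp [A, v, real_inner_comm, hξ]
      have hc : DifferentiableAt ℝ (fun y => (√(metricMatrix f y).det)⁻¹) x := by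
        have h : DifferentiableAt ℝ (fun y => (metricMatrix f y).det) x :=
          (contDiffAt_det fun i j => contDiffAt_metric hf _ _).differentiableAt (by simp)
        exact (h.sqrt (det_metricMatrix_pos he).ne').fun_inv
          (Real.sqrt_pos.mpr (det_metricMatrix_pos he)).ne'
      have hdA : DifferentiableAt ℝ (fun y => (A y).det) x :=
        (contDiffAt_det hA).differentiableAt (by simp)
      have h1 : fderiv ℝ (fun y => gaussMap f y v) x w = 0 := by
        rw [((differentiableAt_gaussMap hf he).hasFDerivAt.continuousAlternatingMap_apply_const
          v).fderiv]
        simp [hw]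
      have h2 : (fun y => gaussMap f y v) = fun y => (√(metricMatrix f y).det)⁻¹ * (A y).det :=
        funext fun y => gaussMap_apply f y v
      rw [h2, fderiv_fun_mul hc hdA] at h1
      have h3 : (A x).det = 0 := Matrix.det_eq_zero_of_row_eq_zero k hk
      simp only [h3, zero_smul, add_zero, smul_apply, smul_eq_mul] at h1
      have h4 := (mul_eq_zero.mp h1).resolve_left
        (inv_ne_zero (Real.sqrt_pos.mpr (det_metricMatrix_pos he)).ne')
      rw [fderiv_det_of_row_eq_zero hA k hk] at h4
      rw [← h4]
      congr 1
      ext a b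
      simp only [Matrix.updateRow_apply]
      split_ifs with hak
      · have hb : DifferentiableAt ℝ (fun y => fderiv ℝ f y (basisVec b)) x :=
          (contDiffAt_fderiv_apply hf _).differentiableAt (by simp)
        simp only [A, Matrix.of_apply]
        rw [fderiv_inner_apply ℝ hb (differentiableAt_const _)]
        simp [hsfd, v, hd]
      · simp [A, v, hak, metricMatrix, metric, real_inner_comm]
    -- By Cramer's rule `d` is determined by the determinants above.
    have hcr : Matrix.cramer (metricMatrix f x).transpose d = 0 := by
      funext k
      rw [Matrix.cramer_transpose_apply, hdet]
      rfl
    have h5 := Matrix.mulVec_cramer (metricMatrix f x).transpose d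
    rw [hcr, Matrix.mulVec_zero, Matrix.det_transpose] at h5
    have h6 := (smul_eq_zero.mp h5.symm).resolve_left (det_metricMatrix_ne_zero he)
    exact fun i => congrFun h6 i
  have hν := inner_secondFundForm_fderiv he w u
  have hsum : ⟪secondFundForm f x w u, secondDeriv f x w u⟫ = 0 := by
    have hu : secondDeriv f x w u = ∑ i, u i • secondDeriv f x w (basisVec i) := by
      conv_lhs => rw [← sum_smul_basisVec u]
      simp [secondDeriv]
    rw [hu, inner_sum]
    refine Finset.sum_eq_zero fun i _ => ?_
    rw [real_inner_smul_right, real_inner_comm, key _ hν, mul_zero]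
  rw [← inner_normalPart_right hν] at hsum
  exact inner_self_eq_zero.mp hsum

end Gauss

/-! ### Relative nullity and `∇B` -/

section Nullity

variable {f : EuclideanSpace ℝ (Fin n) → EuclideanSpace ℝ (Fin N)} {x : EuclideanSpace ℝ (Fin n)}
  {e : Fin n → EuclideanSpace ℝ (Fin n)}

lemma le_finrank_ker_fderiv_gaussMap (h : gaussRank f x ≤ 2) :
    n ≤ Module.finrank ℝ (LinearMap.ker (fderiv ℝ (gaussMap f) x).toLinearMap) + 2 := by
  have h1 := LinearMap.finrank_range_add_finrank_ker (fderiv ℝ (gaussMap f) x).toLinearMap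
  have h2 : Module.finrank ℝ (LinearMap.range (fderiv ℝ (gaussMap f) x).toLinearMap) ≤ 2 := h
  rw [finrank_euclideanSpace_fin] at h1
  omega

lemma exists_sum_smul_mem_ker {V W : Type*} [AddCommGroup V] [Module ℝ V]
    [Module.Finite ℝ V] [AddCommGroup W] [Module ℝ W] (L : V →ₗ[ℝ] W)
    (h : Module.finrank ℝ (LinearMap.range L) ≤ 2) (v : Fin 3 → V) :
    ∃ c : Fin 3 → ℝ, c ≠ 0 ∧ L (∑ j, c j • v j) = 0 := by
  have hdep : ¬ LinearIndependent ℝ fun j => L.rangeRestrict (v j) := fun hli => by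
    have h1 := hli.fintype_card_le_finrank
    rw [Fintype.card_fin] at h1
    omega
  obtain ⟨c, hc, i, hi⟩ := Fintype.not_linearIndependent_iff.mp hdep
  refine ⟨c, fun h0 => hi (by simp [h0]), ?_⟩
  have := congrArg (LinearMap.range L).subtype hc
  simpa using this

/-- If the Gauss map has rank at most two, any three tangent vectors have a nontrivial linear
combination in the relative nullity of `B`. -/
lemma exists_sum_smul_mem_nullity (hf : ContDiffAt ℝ ∞ f x) (he : IsOrthonormalFrame f x e)
    (h : gaussRank f x ≤ 2) (v : Fin 3 → EuclideanSpace ℝ (Fin n)) :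
    ∃ c : Fin 3 → ℝ, c ≠ 0 ∧ ∀ u, ∑ j, c j • secondFundForm f x (v j) u = 0 := by
  obtain ⟨c, hc, hker⟩ := exists_sum_smul_mem_ker (fderiv ℝ (gaussMap f) x).toLinearMap h v
  refine ⟨c, hc, fun u => ?_⟩
  have := secondFundForm_eq_zero_of_fderiv_gaussMap_eq_zero hf he hker u
  rw [← secondFundFormₗ_apply] at this
  simpa only [map_sum, map_smul, LinearMap.sum_apply, LinearMap.smul_apply,
    secondFundFormₗ_apply] using this

/-- If the Gauss map has rank at most two near `x` and `B` has rank two at `x`, then the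
derivative of `B` at `x` vanishes on pairs of nullity vectors. The `3 × 3` minors of `B`, seen as a
linear map `u ↦ B_{u ·}`, vanish near `x`; one of them factors to first order at `x` as the nonzero
number `(|B_{e₁e₁}|² + |B_{e₁e₂}|²)²` times `⟨B_{u z}, ξ⟩`. -/
lemma fderiv_secondFundForm_eq_zero (hf : ContDiffAt ℝ ∞ f x) (he : IsOrthonormalFrame f x e)
    (hreg : ∀ᶠ y in nhds x, ContDiffAt ℝ ∞ f y ∧ Function.Injective (fderiv ℝ f y) ∧
      gaussRank f y ≤ 2)
    {e₁ e₂ : EuclideanSpace ℝ (Fin n)}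
    (htr : secondFundForm f x e₂ e₂ = -secondFundForm f x e₁ e₁)
    (hne : ⟪secondFundForm f x e₁ e₁, secondFundForm f x e₁ e₁⟫
      + ⟪secondFundForm f x e₁ e₂, secondFundForm f x e₁ e₂⟫ ≠ 0)
    {u z : EuclideanSpace ℝ (Fin n)} (hu : ∀ v, secondFundForm f x u v = 0)
    (hz : ∀ v, secondFundForm f x z v = 0) (w : EuclideanSpace ℝ (Fin n)) :
    fderiv ℝ (fun y => secondFundForm f y u z) x w = 0 := by
  set a := secondFundForm f x e₁ e₁ with ha
  set b := secondFundForm f x e₁ e₂ with hb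
  have hb' : secondFundForm f x e₂ e₁ = b := secondFundForm_comm hf _ _
  have hz' : ∀ v, secondFundForm f x v z = 0 := fun v => by rw [secondFundForm_comm hf, hz]
  set ξ := fderiv ℝ (fun y => secondFundForm f y u z) x w with hξ
  -- The minor has columns `B_{e₁ ·}`, `B_{e₂ ·}`, `B_{u ·}`; its rows are the inner products with
  -- `B_{e₁ ·}` and `B_{e₂ ·}` on the span of `e₁`, `e₂`, and the functional `L ↦ ⟨L z, ξ⟩`.
  -- At `x` it is diagonal with last entry zero.
  let v : Fin 3 → EuclideanSpace ℝ (Fin n) := ![e₁, e₂, u]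
  let p : Fin 3 → Fin 2 → EuclideanSpace ℝ (Fin n) := ![![e₁, e₂], ![e₁, e₂], ![z, z]]
  let q : Fin 3 → Fin 2 → EuclideanSpace ℝ (Fin N) := ![![a, b], ![b, -a], ![ξ, 0]]
  let A : EuclideanSpace ℝ (Fin n) → Matrix (Fin 3) (Fin 3) ℝ := fun y =>
    Matrix.of fun r j => ∑ s, ⟪secondFundForm f y (v j) (p r s), q r s⟫
  have hdet : (fun y => (A y).det) =ᶠ[nhds x] fun _ => 0 := by
    filter_upwards [hreg] with y ⟨hfy, hinj, hrank⟩
    obtain ⟨e', he'⟩ := exists_isOrthonormalFrame hinj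
    obtain ⟨c, hc0, hc⟩ := exists_sum_smul_mem_nullity hfy he' hrank v
    refine Matrix.exists_mulVec_eq_zero_iff.mp ⟨c, hc0, ?_⟩
    funext r
    simp only [Matrix.mulVec, dotProduct, A, Matrix.of_apply, Finset.sum_mul, Pi.zero_apply]
    rw [Finset.sum_comm]
    refine Finset.sum_eq_zero fun s _ => ?_
    have := congrArg (fun η => ⟪η, q r s⟫) (hc (p r s))
    simp only [sum_inner, real_inner_smul_left, inner_zero_left] at this
    rw [← this]
    exact Finset.sum_congr rfl fun j _ => mul_comm _ _
  have hA : ∀ i j, ContDiffAt ℝ ∞ (fun y => A y i j) x := fun i j => by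
    simp only [A, Matrix.of_apply]
    exact ContDiffAt.sum fun s _ => (contDiffAt_secondFundForm hf he _ _).inner ℝ contDiffAt_const
  have hrow : ∀ j, A x 2 j = 0 := fun j => by
    simp [A, p, q, hz', Fin.sum_univ_two]
  have h0 : fderiv ℝ (fun y => (A y).det) x w = 0 := by
    rw [hdet.fderiv_eq]; simp
  rw [fderiv_det_of_row_eq_zero hA 2 hrow, Matrix.det_fin_three] at h0
  have hd : fderiv ℝ (fun y => A y 2 2) x w = ⟪ξ, ξ⟫ := by
    have h1 : (fun y => A y 2 2) = fun y => ⟪secondFundForm f y u z, ξ⟫ := by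
      funext y
      simp [A, p, q, v, Fin.sum_univ_two]
    rw [h1, fderiv_inner_apply ℝ (differentiableAt_secondFundForm hf he u z)
      (differentiableAt_const _)]
    simp [hξ]
  have h00 : A x 0 0 = ⟪a, a⟫ + ⟪b, b⟫ := by simp [A, p, q, v, ← ha, ← hb]
  have h01 : A x 0 1 = 0 := by
    simp [A, p, q, v, hb', htr, real_inner_comm]
  have h10 : A x 1 0 = 0 := by
    simp [A, p, q, v, ← ha, ← hb, real_inner_comm]
  have h11 : A x 1 1 = ⟪a, a⟫ + ⟪b, b⟫ := by
    simp [A, p, q, v, hb', htr, add_comm]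
  have h02 : A x 0 2 = 0 := by simp [A, v, hu]
  have h12 : A x 1 2 = 0 := by simp [A, v, hu]
  simp [Matrix.updateRow_apply, h00, h01, h10, h11, h02, h12, hd] at h0
  rcases h0 with h0 | h0
  · exact absurd h0 (by simpa using hne)
  · exact h0

/-- Under the same assumptions, `∇B` vanishes on pairs of nullity vectors. -/
lemma covDerivB_eq_zero_of_nullity (hf : ContDiffAt ℝ ∞ f x) (he : IsOrthonormalFrame f x e)
    (hreg : ∀ᶠ y in nhds x, ContDiffAt ℝ ∞ f y ∧ Function.Injective (fderiv ℝ f y) ∧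
      gaussRank f y ≤ 2)
    {e₁ e₂ : EuclideanSpace ℝ (Fin n)}
    (htr : secondFundForm f x e₂ e₂ = -secondFundForm f x e₁ e₁)
    (hne : ⟪secondFundForm f x e₁ e₁, secondFundForm f x e₁ e₁⟫
      + ⟪secondFundForm f x e₁ e₂, secondFundForm f x e₁ e₂⟫ ≠ 0)
    {u z : EuclideanSpace ℝ (Fin n)} (hu : ∀ v, secondFundForm f x u v = 0)
    (hz : ∀ v, secondFundForm f x z v = 0) (w : EuclideanSpace ℝ (Fin n)) :
    covDerivB f x w u z = 0 := by
  rw [covDerivB, fderiv_secondFundForm_eq_zero hf he hreg htr hne hu hz w, hu,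
    secondFundForm_comm hf _ z, hz]
  simp

end Nullity

/-! ### Points where `B` vanishes -/

section Flat

variable {f : EuclideanSpace ℝ (Fin n) → EuclideanSpace ℝ (Fin N)} {x : EuclideanSpace ℝ (Fin n)}
  {e : Fin n → EuclideanSpace ℝ (Fin n)}

lemma norm_secondFundForm_frame_le (he : IsOrthonormalFrame f x e) (k l : Fin n) :
    ‖secondFundForm f x (e k) (e l)‖ ≤ normB f x := by
  refine Real.le_sqrt_of_sq_le ?_
  rw [normSqB_eq_sum he, ← real_inner_self_eq_norm_sq]
  have h1 := Finset.single_le_sum (s := Finset.univ)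
    (f := fun l => ⟪secondFundForm f x (e k) (e l), secondFundForm f x (e k) (e l)⟫)
    (fun _ _ => real_inner_self_nonneg) (Finset.mem_univ l)
  have h2 := Finset.single_le_sum (s := Finset.univ)
    (f := fun k => ∑ l, ⟪secondFundForm f x (e k) (e l), secondFundForm f x (e k) (e l)⟫)
    (fun _ _ => Finset.sum_nonneg fun _ _ => real_inner_self_nonneg) (Finset.mem_univ k)
  exact h1.trans h2

lemma norm_secondFundForm_le (he : IsOrthonormalFrame f x e) (u v : EuclideanSpace ℝ (Fin n)) :
    ‖secondFundForm f x u v‖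
      ≤ n * n * (‖fderiv ℝ f x u‖ * ‖fderiv ℝ f x v‖) * normB f x := by
  have hcoef : ∀ u k, |metric f x u (e k)| ≤ ‖fderiv ℝ f x u‖ := fun u k => by
    have h1 : ‖fderiv ℝ f x (e k)‖ = 1 := by
      have := he k k
      rw [metric, if_pos rfl, real_inner_self_eq_norm_sq] at this
      nlinarith [norm_nonneg (fderiv ℝ f x (e k))]
    simpa [metric, h1] using abs_real_inner_le_norm (fderiv ℝ f x u) (fderiv ℝ f x (e k))
  have hexp : secondFundForm f x u v = ∑ k, ∑ l, (metric f x u (e k) * metric f x v (e l)) •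
      secondFundForm f x (e k) (e l) := by
    rw [← secondFundFormₗ_apply]
    conv_lhs => rw [← sum_metric_smul he u, ← sum_metric_smul he v]
    simp only [map_sum, map_smul, LinearMap.sum_apply, LinearMap.smul_apply, Finset.smul_sum,
      smul_smul, secondFundFormₗ_apply]
    rw [Finset.sum_comm]
    refine Finset.sum_congr rfl fun k _ => Finset.sum_congr rfl fun l _ => ?_
    rw [mul_comm]
  rw [hexp]
  have hterm : ∀ k l, ‖(metric f x u (e k) * metric f x v (e l)) • secondFundForm f x (e k) (e l)‖
      ≤ (‖fderiv ℝ f x u‖ * ‖fderiv ℝ f x v‖) * normB f x := fun k l => by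
    rw [norm_smul, Real.norm_eq_abs, abs_mul]
    exact mul_le_mul (mul_le_mul (hcoef u k) (hcoef v l) (abs_nonneg _) (norm_nonneg _))
      (norm_secondFundForm_frame_le he k l) (norm_nonneg _) (by positivity)
  refine (norm_sum_le_of_le _ fun k _ => norm_sum_le_of_le _ fun l _ => hterm k l).trans ?_
  simp [mul_assoc]

lemma secondFundForm_eq_zero_of_normB_eq_zero (he : IsOrthonormalFrame f x e)
    (h0 : normB f x = 0) (u v : EuclideanSpace ℝ (Fin n)) : secondFundForm f x u v = 0 := by
  have := norm_secondFundForm_le he u v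
  rw [h0, mul_zero] at this
  exact norm_le_zero_iff.mp this

/-- At a zero of `|B|` the function `|B| ≥ 0` attains its minimum. -/
lemma fderiv_normB_eq_zero (h0 : normB f x = 0) : fderiv ℝ (normB f) x = 0 :=
  IsLocalMin.fderiv_eq_zero (Filter.Eventually.of_forall fun y => by
    rw [h0]; exact Real.sqrt_nonneg _)

/-- At a zero of `B` where `|B|` is differentiable, `∇B` vanishes: `|B|` is then `o(|y - x|)`, and
it dominates the components of `B`. -/
lemma covDerivB_eq_zero_of_normB_eq_zero (hf : ContDiffAt ℝ ∞ f x)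
    (hreg : ∀ᶠ y in nhds x, Function.Injective (fderiv ℝ f y))
    (h0 : normB f x = 0) (hd : DifferentiableAt ℝ (normB f) x) (w u v : EuclideanSpace ℝ (Fin n)) :
    covDerivB f x w u v = 0 := by
  obtain ⟨e, he⟩ := exists_isOrthonormalFrame hreg.self_of_nhds
  have hB := secondFundForm_eq_zero_of_normB_eq_zero he h0
  have hN := hd.hasFDerivAt
  rw [fderiv_normB_eq_zero h0, hasFDerivAt_iff_isLittleO] at hN
  simp only [h0, sub_zero, zero_apply] at hN
  have hO : (fun y => secondFundForm f y u v) =O[nhds x] normB f := by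
    have hc : ∀ u, ∀ᶠ y in nhds x, ‖fderiv ℝ f y u‖ ≤ ‖fderiv ℝ f x u‖ + 1 := fun u =>
      ((contDiffAt_fderiv_apply hf u).continuousAt.norm.eventually_lt_const
        (lt_add_one _)).mono fun _ h => h.le
    refine Asymptotics.IsBigO.of_bound
      (n * n * ((‖fderiv ℝ f x u‖ + 1) * (‖fderiv ℝ f x v‖ + 1))) ?_
    filter_upwards [hreg, hc u, hc v] with y hy h1 h2
    obtain ⟨e', he'⟩ := exists_isOrthonormalFrame hy
    refine (norm_secondFundForm_le he' u v).trans ?_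
    have hN0 : 0 ≤ normB f y := Real.sqrt_nonneg _
    rw [Real.norm_of_nonneg hN0]
    gcongr
  have h : HasFDerivAt (fun y => secondFundForm f y u v)
      (0 : EuclideanSpace ℝ (Fin n) →L[ℝ] EuclideanSpace ℝ (Fin N)) x := by
    rw [hasFDerivAt_iff_isLittleO]
    simpa [hB] using hO.trans_isLittleO hN
  rw [covDerivB, h.fderiv, hB, hB]
  simp

end Flat

/-! ### The algebra of the refined Kato inequality -/

section Algebra

variable {V : Type*} [NormedAddCommGroup V] [InnerProductSpace ℝ V]

lemma sum_fin_add_two {M : Type*} [AddCommMonoid M] {k : ℕ} (g : Fin (k + 2) → M) :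
    ∑ p, g p = g 0 + g 1 + ∑ i : Fin k, g i.succ.succ := by
  rw [Fin.sum_univ_succ, Fin.sum_univ_succ]
  exact (add_assoc _ _ _).symm

lemma eq_zero_or_one_or_succ_succ {k : ℕ} (p : Fin (k + 2)) :
    p = 0 ∨ p = 1 ∨ ∃ i : Fin k, p = i.succ.succ :=
  Fin.cases (Or.inl rfl) (fun q => Fin.cases (Or.inr (Or.inl rfl))
    (fun i => Or.inr (Or.inr ⟨i, rfl⟩)) q) p

/-- The Cauchy–Schwarz defect for the complex vectors `a + i b` and `X + i Y`: the distance of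
`X + i Y` to the complex line through `a + i b`. -/
lemma sq_norm_sub_complex_multiple (a b X Y : V) (h : ⟪a, a⟫ + ⟪b, b⟫ ≠ 0) :
    let β := ⟪a, a⟫ + ⟪b, b⟫
    let P := ⟪a, X⟫ + ⟪b, Y⟫
    let R := ⟪a, Y⟫ - ⟪b, X⟫
    ‖X - ((P / β) • a - (R / β) • b)‖ ^ 2 + ‖Y - ((R / β) • a + (P / β) • b)‖ ^ 2
      = ⟪X, X⟫ + ⟪Y, Y⟫ - (P ^ 2 + R ^ 2) / β := by
  intro β P R
  have hβ : β ≠ 0 := h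
  have key : ∀ s t : ℝ, ‖X - (s • a - t • b)‖ ^ 2 + ‖Y - (t • a + s • b)‖ ^ 2
      = ⟪X, X⟫ + ⟪Y, Y⟫ + (s ^ 2 + t ^ 2) * β - 2 * s * P - 2 * t * R := by
    intro s t
    rw [← real_inner_self_eq_norm_sq, ← real_inner_self_eq_norm_sq]
    simp only [inner_sub_left, inner_sub_right, inner_add_left, inner_add_right,
      real_inner_smul_left, real_inner_smul_right, β, P, R]
    rw [real_inner_comm X a, real_inner_comm X b, real_inner_comm Y a, real_inner_comm Y b,
      real_inner_comm a b]
    ring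
  rw [key]
  field_simp
  ring

/-- The squared norm of a symmetric trace-free cubic form `T` that vanishes on pairs of nullity
directions. By symmetry each component with one nullity index is counted three times. -/
lemma sum_inner_cubic {k : ℕ} (T : Fin (k + 2) → Fin (k + 2) → Fin (k + 2) → V)
    (hl : ∀ p q r, T p q r = T q p r) (hr : ∀ p q r, T p q r = T p r q)
    (hnull : ∀ p (i j : Fin k), T p i.succ.succ j.succ.succ = 0)
    (htr : ∀ p, T p 1 1 = -T p 0 0) :
    ∑ p, ∑ q, ∑ r, ⟪T p q r, T p q r⟫
      = 4 * (⟪T 0 0 0, T 0 0 0⟫ + ⟪T 0 0 1, T 0 0 1⟫)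
        + ∑ i : Fin k, 6 * (⟪T i.succ.succ 0 0, T i.succ.succ 0 0⟫
          + ⟪T i.succ.succ 0 1, T i.succ.succ 0 1⟫) := by
  have h010 : T 0 1 0 = T 0 0 1 := hr _ _ _
  have h100 : T 1 0 0 = T 0 0 1 := by rw [hl, h010]
  have h011 : T 0 1 1 = -T 0 0 0 := htr 0
  have h101 : T 1 0 1 = -T 0 0 0 := by rw [hl, h011]
  have h110 : T 1 1 0 = -T 0 0 0 := by rw [hr, h101]
  have h111 : T 1 1 1 = -T 0 0 1 := by rw [htr, h100]
  have hi10 : ∀ i : Fin k, T i.succ.succ 1 0 = T i.succ.succ 0 1 := fun i => hr _ _ _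
  have hi11 : ∀ i : Fin k, T i.succ.succ 1 1 = -T i.succ.succ 0 0 := fun i => htr _
  have h1 : ∀ (i : Fin k) p q, T p i.succ.succ q = T i.succ.succ p q := fun i p q => hl _ _ _
  have h2 : ∀ (i : Fin k) p q, T p q i.succ.succ = T i.succ.succ p q := fun i p q => by
    rw [hr, hl]
  have hz1 : ∀ (i j : Fin k) p, T i.succ.succ j.succ.succ p = 0 := fun i j p => by
    rw [hr, hl, hnull]
  have hz2 : ∀ (i j : Fin k) p, T i.succ.succ p j.succ.succ = 0 := fun i j p => by
    rw [hr, hz1]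
  simp only [sum_fin_add_two, h010, h100, h011, h101, h110, h111, hi10, hi11, inner_neg_neg]
  simp only [h1 _ 0, h1 _ 1, h2 _ 0, h2 _ 1, hz1, hz2, hi10, hi11, inner_neg_neg, inner_zero_left,
    Finset.sum_const_zero, Finset.sum_add_distrib, add_zero, ← Finset.mul_sum]
  ring

end Algebra

/-! ### The refined Kato inequality in an adapted frame -/

section Kato

variable {k : ℕ} {f : EuclideanSpace ℝ (Fin (k + 2)) → EuclideanSpace ℝ (Fin N)}
  {x : EuclideanSpace ℝ (Fin (k + 2))} {e : Fin (k + 2) → EuclideanSpace ℝ (Fin (k + 2))}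

/-- A nullity-adapted frame: an orthonormal frame `e` in which `B` and `∇B` have the algebraic
structure coming from minimality and from Gauss rank two. All frame vectors but the first two lie in
the nullity of `B`, `∇B` vanishes on pairs of them, and the trace conditions accordingly involve only
the first two. The frame is indexed from `0`; mathematical notation such as `B₁₁` in the comments
counts from one. -/
structure IsAdaptedFrame (f : EuclideanSpace ℝ (Fin (k + 2)) → EuclideanSpace ℝ (Fin N))
    (x : EuclideanSpace ℝ (Fin (k + 2)))
    (e : Fin (k + 2) → EuclideanSpace ℝ (Fin (k + 2))) : Prop where
  orthonormal : IsOrthonormalFrame f x e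
  nullity : ∀ (i : Fin k) v, secondFundForm f x (e i.succ.succ) v = 0
  trace : secondFundForm f x (e 1) (e 1) = -secondFundForm f x (e 0) (e 0)
  covNullity : ∀ w (i j : Fin k), covDerivB f x w (e i.succ.succ) (e j.succ.succ) = 0
  covTrace : ∀ w, covDerivB f x w (e 1) (e 1) = -covDerivB f x w (e 0) (e 0)

lemma normSqB_eq_of_nullity (hf : ContDiffAt ℝ ∞ f x) (he : IsOrthonormalFrame f x e)
    (hnull : ∀ (i : Fin k) v, secondFundForm f x (e i.succ.succ) v = 0)
    (htr : secondFundForm f x (e 1) (e 1) = -secondFundForm f x (e 0) (e 0)) :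
    normSqB f x = 2 * (⟪secondFundForm f x (e 0) (e 0), secondFundForm f x (e 0) (e 0)⟫
      + ⟪secondFundForm f x (e 0) (e 1), secondFundForm f x (e 0) (e 1)⟫) := by
  have h' : ∀ (i : Fin k) v, secondFundForm f x v (e i.succ.succ) = 0 := fun i v => by
    rw [secondFundForm_comm hf, hnull]
  rw [normSqB_eq_sum he]
  simp only [sum_fin_add_two, hnull, h', htr, secondFundForm_comm hf (e 1) (e 0),
    inner_neg_neg, inner_zero_left, Finset.sum_const_zero, add_zero]
  ring

lemma IsAdaptedFrame.normSqB_eq (h : IsAdaptedFrame f x e) (hf : ContDiffAt ℝ ∞ f x) :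
    normSqB f x = 2 * (⟪secondFundForm f x (e 0) (e 0), secondFundForm f x (e 0) (e 0)⟫
      + ⟪secondFundForm f x (e 0) (e 1), secondFundForm f x (e 0) (e 1)⟫) :=
  normSqB_eq_of_nullity hf h.orthonormal h.nullity h.trace

/-- The derivative of `|B|²` in an adapted frame. -/
lemma IsAdaptedFrame.fderiv_normSqB_eq (h : IsAdaptedFrame f x e) (hf : ContDiffAt ℝ ∞ f x)
    (w : EuclideanSpace ℝ (Fin (k + 2))) :
    fderiv ℝ (normSqB f) x w = 4 * (⟪secondFundForm f x (e 0) (e 0), covDerivB f x w (e 0) (e 0)⟫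
      + ⟪secondFundForm f x (e 0) (e 1), covDerivB f x w (e 0) (e 1)⟫) := by
  have h' : ∀ (i : Fin k) v, secondFundForm f x v (e i.succ.succ) = 0 := fun i v => by
    rw [secondFundForm_comm hf, h.nullity]
  rw [fderiv_normSqB hf h.orthonormal]
  simp only [sum_fin_add_two, h.nullity, h', h.trace, secondFundForm_comm hf (e 1) (e 0),
    covDerivB_comm_right hf w (e 1) (e 0), h.covTrace,
    inner_neg_neg, inner_zero_left, Finset.sum_const_zero, add_zero]
  ring

/-- The Kato defect `|∇B|² - 2 |∇|B||²` in an adapted frame, as a sum of nonnegative terms. With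
`A = B₁₁ + i B₁₂` and `Z = (∇₁B)₁₁ + i (∇₁B)₁₂`, the first summand is four times the squared
distance of `Z` to the complex line through `A`, by `sq_norm_sub_complex_multiple`. -/
lemma IsAdaptedFrame.kato_defect (h : IsAdaptedFrame f x e) (hf : ContDiffAt ℝ ∞ f x)
    (h0 : normB f x ≠ 0) {a b X Y : EuclideanSpace ℝ (Fin N)}
    (ha : secondFundForm f x (e 0) (e 0) = a) (hb : secondFundForm f x (e 0) (e 1) = b)
    (hX : covDerivB f x (e 0) (e 0) (e 0) = X) (hY : covDerivB f x (e 0) (e 0) (e 1) = Y) :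
    normSqCovDerivB f x - 2 * normSqGrad f (normB f) x
      = 4 * (⟪X, X⟫ + ⟪Y, Y⟫
          - ((⟪a, X⟫ + ⟪b, Y⟫) ^ 2 + (⟪a, Y⟫ - ⟪b, X⟫) ^ 2) / (⟪a, a⟫ + ⟪b, b⟫))
        + ∑ i : Fin k,
          (6 * (⟪covDerivB f x (e i.succ.succ) (e 0) (e 0),
              covDerivB f x (e i.succ.succ) (e 0) (e 0)⟫
            + ⟪covDerivB f x (e i.succ.succ) (e 0) (e 1),
              covDerivB f x (e i.succ.succ) (e 0) (e 1)⟫)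
          - 4 * (⟪a, covDerivB f x (e i.succ.succ) (e 0) (e 0)⟫
            + ⟪b, covDerivB f x (e i.succ.succ) (e 0) (e 1)⟫) ^ 2 / (⟪a, a⟫ + ⟪b, b⟫)) := by
  have he := h.orthonormal
  have hsq : normSqB f x = 2 * (⟪a, a⟫ + ⟪b, b⟫) := by rw [h.normSqB_eq hf, ha, hb]
  have hne : normSqB f x ≠ 0 := fun hh => h0 (by simp [normB, hh])
  have hpos : 0 ≤ normSqB f x := by
    rw [hsq]
    have := real_inner_self_nonneg (x := a)
    have := real_inner_self_nonneg (x := b)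
    positivity
  have hβ : ⟪a, a⟫ + ⟪b, b⟫ ≠ 0 := fun hh => hne (by rw [hsq, hh, mul_zero])
  have hgrad : ∀ w, fderiv ℝ (normB f) x w ^ 2
      = 2 * (⟪a, covDerivB f x w (e 0) (e 0)⟫ + ⟪b, covDerivB f x w (e 0) (e 1)⟫) ^ 2
        / (⟪a, a⟫ + ⟪b, b⟫) := by
    intro w
    have hd : fderiv ℝ (normB f) x = (1 / (2 * √(normSqB f x))) • fderiv ℝ (normSqB f) x :=
      fderiv_sqrt ((contDiffAt_normSqB hf he).differentiableAt (by simp)) hne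
    rw [hd, smul_apply, smul_eq_mul, mul_pow, div_pow, mul_pow, Real.sq_sqrt hpos,
      h.fderiv_normSqB_eq hf, ha, hb, hsq]
    field_simp
    ring
  have hT := sum_inner_cubic (fun p q r => covDerivB f x (e p) (e q) (e r))
    (fun p q r => covDerivB_comm_left hf he _ _ _) (fun p q r => covDerivB_comm_right hf _ _ _)
    (fun p i j => h.covNullity _ i j) (fun p => h.covTrace _)
  have h100 : covDerivB f x (e 1) (e 0) (e 0) = Y := by
    rw [covDerivB_comm_left hf he, covDerivB_comm_right hf, hY]
  have h101 : covDerivB f x (e 1) (e 0) (e 1) = -X := by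
    rw [covDerivB_comm_left hf he, h.covTrace, hX]
  rw [normSqCovDerivB_eq_sum hf he, hT, normSqGrad_eq_sum he, sum_fin_add_two]
  simp only [hgrad, hX, hY, h100, h101, inner_neg_right, Finset.sum_sub_distrib]
  have hs : ∀ c : Fin k → ℝ, ∑ i, 4 * c i / (⟪a, a⟫ + ⟪b, b⟫)
      = 2 * ∑ i, 2 * c i / (⟪a, a⟫ + ⟪b, b⟫) := fun c => by
    rw [Finset.mul_sum]
    exact Finset.sum_congr rfl fun i _ => by ring
  rw [hs]
  field_simp
  ring

/-- The Cauchy–Schwarz inequality behind the estimate of the derivatives of `B` along the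
nullity. -/
lemma cauchySchwarz_pair {V : Type*} [NormedAddCommGroup V] [InnerProductSpace ℝ V]
    (a b u v : V) (hβ : 0 < ⟪a, a⟫ + ⟪b, b⟫) :
    2 * (⟪u, u⟫ + ⟪v, v⟫) ≤ 6 * (⟪u, u⟫ + ⟪v, v⟫)
      - 4 * (⟪a, u⟫ + ⟪b, v⟫) ^ 2 / (⟪a, a⟫ + ⟪b, b⟫) := by
  have h : (⟪a, u⟫ + ⟪b, v⟫) ^ 2 ≤ (⟪a, a⟫ + ⟪b, b⟫) * (⟪u, u⟫ + ⟪v, v⟫) := by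
    have h1 := abs_le.mp (abs_real_inner_le_norm a u)
    have h2 := abs_le.mp (abs_real_inner_le_norm b v)
    simp only [real_inner_self_eq_norm_sq]
    have h3 : |⟪a, u⟫ + ⟪b, v⟫| ≤ ‖a‖ * ‖u‖ + ‖b‖ * ‖v‖ :=
      abs_le.mpr ⟨by linarith, by linarith⟩
    have h4 := sq_le_sq' (by linarith [abs_nonneg (⟪a, u⟫ + ⟪b, v⟫)]) h3
    rw [sq_abs] at h4
    nlinarith [sq_nonneg (‖a‖ * ‖v‖ - ‖b‖ * ‖u‖)]
  rw [mul_div_assoc]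
  have h5 : (⟪a, u⟫ + ⟪b, v⟫) ^ 2 / (⟪a, a⟫ + ⟪b, b⟫) ≤ ⟪u, u⟫ + ⟪v, v⟫ := by
    rw [div_le_iff₀ hβ]
    linarith
  linarith

lemma IsAdaptedFrame.sum_inner_pos (h : IsAdaptedFrame f x e) (hf : ContDiffAt ℝ ∞ f x)
    (h0 : normB f x ≠ 0) :
    0 < ⟪secondFundForm f x (e 0) (e 0), secondFundForm f x (e 0) (e 0)⟫
      + ⟪secondFundForm f x (e 0) (e 1), secondFundForm f x (e 0) (e 1)⟫ := by
  refine lt_of_le_of_ne (add_nonneg real_inner_self_nonneg real_inner_self_nonneg) fun hh => h0 ?_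
  rw [normB, h.normSqB_eq hf, ← hh]
  simp

/-- The refined Kato inequality at a point where `B ≠ 0`. -/
lemma IsAdaptedFrame.kato (h : IsAdaptedFrame f x e) (hf : ContDiffAt ℝ ∞ f x)
    (h0 : normB f x ≠ 0) :
    2 * normSqGrad f (normB f) x ≤ normSqCovDerivB f x := by
  have hpos := h.sum_inner_pos hf h0
  have hdef := h.kato_defect hf h0 rfl rfl rfl rfl
  rw [← sq_norm_sub_complex_multiple _ _ _ _ hpos.ne'] at hdef
  rw [← sub_nonneg, hdef]
  refine add_nonneg (by positivity) (Finset.sum_nonneg fun i _ => ?_)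
  refine le_trans ?_ (cauchySchwarz_pair _ _ _ _ hpos)
  have := real_inner_self_nonneg (x := covDerivB f x (e i.succ.succ) (e 0) (e 0))
  have := real_inner_self_nonneg (x := covDerivB f x (e i.succ.succ) (e 0) (e 1))
  positivity

/-- Equality in the refined Kato inequality, in terms of an adapted frame. -/
lemma IsAdaptedFrame.kato_eq_iff (h : IsAdaptedFrame f x e) (hf : ContDiffAt ℝ ∞ f x)
    (h0 : normB f x ≠ 0) :
    normSqCovDerivB f x = 2 * normSqGrad f (normB f) x ↔
      (∃ l₁ l₂ : ℝ,
        covDerivB f x (e 0) (e 0) (e 0)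
          = l₁ • secondFundForm f x (e 0) (e 0) - l₂ • secondFundForm f x (e 0) (e 1) ∧
        covDerivB f x (e 1) (e 0) (e 0)
          = l₂ • secondFundForm f x (e 0) (e 0) + l₁ • secondFundForm f x (e 0) (e 1)) ∧
      ∀ i : Fin k, covDerivB f x (e i.succ.succ) (e 0) (e 0) = 0 ∧
        covDerivB f x (e i.succ.succ) (e 0) (e 1) = 0 := by
  have hpos := h.sum_inner_pos hf h0
  have hY : covDerivB f x (e 1) (e 0) (e 0) = covDerivB f x (e 0) (e 0) (e 1) := by
    rw [covDerivB_comm_left hf h.orthonormal, covDerivB_comm_right hf]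
  rw [hY, ← sub_eq_zero, h.kato_defect hf h0 rfl rfl rfl rfl]
  set a := secondFundForm f x (e 0) (e 0)
  set b := secondFundForm f x (e 0) (e 1)
  set X := covDerivB f x (e 0) (e 0) (e 0)
  set Y := covDerivB f x (e 0) (e 0) (e 1)
  constructor
  · intro hdef
    rw [← sq_norm_sub_complex_multiple _ _ _ _ hpos.ne'] at hdef
    have hterm : ∀ i ∈ (Finset.univ : Finset (Fin k)), 0 ≤
        (6 * (⟪covDerivB f x (e i.succ.succ) (e 0) (e 0),
              covDerivB f x (e i.succ.succ) (e 0) (e 0)⟫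
            + ⟪covDerivB f x (e i.succ.succ) (e 0) (e 1),
              covDerivB f x (e i.succ.succ) (e 0) (e 1)⟫)
          - 4 * (⟪a, covDerivB f x (e i.succ.succ) (e 0) (e 0)⟫
            + ⟪b, covDerivB f x (e i.succ.succ) (e 0) (e 1)⟫) ^ 2 / (⟪a, a⟫ + ⟪b, b⟫)) :=
      fun i _ => (mul_nonneg zero_le_two
        (add_nonneg real_inner_self_nonneg real_inner_self_nonneg)).trans
        (cauchySchwarz_pair _ _ _ _ hpos)
    have hsum := Finset.sum_nonneg hterm
    constructor
    · refine ⟨(⟪a, X⟫ + ⟪b, Y⟫) / (⟪a, a⟫ + ⟪b, b⟫), (⟪a, Y⟫ - ⟪b, X⟫) / (⟪a, a⟫ + ⟪b, b⟫), ?_, ?_⟩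
      · rw [← sub_eq_zero, ← norm_eq_zero, ← sq_eq_zero_iff]
        refine le_antisymm ?_ (sq_nonneg _)
        linarith [sq_nonneg ‖Y - (((⟪a, Y⟫ - ⟪b, X⟫) / (⟪a, a⟫ + ⟪b, b⟫)) • a
          + ((⟪a, X⟫ + ⟪b, Y⟫) / (⟪a, a⟫ + ⟪b, b⟫)) • b)‖]
      · rw [← sub_eq_zero, ← norm_eq_zero, ← sq_eq_zero_iff]
        refine le_antisymm ?_ (sq_nonneg _)
        linarith [sq_nonneg ‖X - (((⟪a, X⟫ + ⟪b, Y⟫) / (⟪a, a⟫ + ⟪b, b⟫)) • a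
          - ((⟪a, Y⟫ - ⟪b, X⟫) / (⟪a, a⟫ + ⟪b, b⟫)) • b)‖]
    · have hs0 := le_antisymm (by
        refine le_trans ?_ hdef.le
        exact le_add_of_nonneg_left (by positivity)) hsum
      intro i
      have hi := (Finset.sum_eq_zero_iff_of_nonneg hterm).mp hs0 i (Finset.mem_univ i)
      have hcs := cauchySchwarz_pair a b (covDerivB f x (e i.succ.succ) (e 0) (e 0))
        (covDerivB f x (e i.succ.succ) (e 0) (e 1)) hpos
      rw [hi] at hcs
      have h1 := real_inner_self_nonneg (x := covDerivB f x (e i.succ.succ) (e 0) (e 0))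
      have h2 := real_inner_self_nonneg (x := covDerivB f x (e i.succ.succ) (e 0) (e 1))
      exact ⟨inner_self_eq_zero.mp (le_antisymm (by linarith) h1),
        inner_self_eq_zero.mp (le_antisymm (by linarith) h2)⟩
  · rintro ⟨⟨l₁, l₂, hX, hY⟩, hU⟩
    simp only [hU, inner_zero_right, hX, hY]
    simp only [inner_sub_left, inner_sub_right, inner_add_left, inner_add_right,
      real_inner_smul_left, real_inner_smul_right, real_inner_comm a b]
    have hβ := hpos.ne'
    simp only [add_zero, mul_zero, ne_eq, OfNat.ofNat_ne_zero, not_false_eq_true, zero_pow,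
      zero_div, sub_zero, Finset.sum_const_zero]
    field_simp
    ring

end Kato

/-! ### Existence of adapted frames -/

section Existence

variable {k : ℕ} {f : EuclideanSpace ℝ (Fin (k + 2)) → EuclideanSpace ℝ (Fin N)}
  {x : EuclideanSpace ℝ (Fin (k + 2))} {e : Fin (k + 2) → EuclideanSpace ℝ (Fin (k + 2))}

lemma secondFundForm_trace_of_nullity (he : IsOrthonormalFrame f x e)
    (hH : meanCurvature f x = 0)
    (hnull : ∀ (i : Fin k) v, secondFundForm f x (e i.succ.succ) v = 0) :
    secondFundForm f x (e 1) (e 1) = -secondFundForm f x (e 0) (e 0) := by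
  rw [meanCurvature_eq_sum he, sum_fin_add_two] at hH
  simp only [hnull, Finset.sum_const_zero, add_zero] at hH
  exact eq_neg_of_add_eq_zero_right hH

/-- On a minimal submanifold the trace conditions on an adapted frame follow from the nullity
conditions. -/
lemma isAdaptedFrame_of_nullity (hf : ContDiffAt ℝ ∞ f x) (he : IsOrthonormalFrame f x e)
    (hH : ∀ᶠ y in nhds x, meanCurvature f y = 0)
    (hnull : ∀ (i : Fin k) v, secondFundForm f x (e i.succ.succ) v = 0)
    (hcov : ∀ w (i j : Fin k), covDerivB f x w (e i.succ.succ) (e j.succ.succ) = 0) :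
    IsAdaptedFrame f x e where
  orthonormal := he
  nullity := hnull
  trace := secondFundForm_trace_of_nullity he hH.self_of_nhds hnull
  covNullity := hcov
  covTrace w := by
    have h := sum_covDerivB_eq_zero hf he hH w
    rw [sum_fin_add_two] at h
    simp only [hcov, Finset.sum_const_zero, add_zero] at h
    exact eq_neg_of_add_eq_zero_right h

/-- The frame obtained by rotating the first two vectors of `e` by the angle `θ`. -/
noncomputable def rotateFrame (e : Fin (k + 2) → EuclideanSpace ℝ (Fin (k + 2))) (θ : ℝ) :
    Fin (k + 2) → EuclideanSpace ℝ (Fin (k + 2)) :=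
  Fin.cons (Real.cos θ • e 0 + Real.sin θ • e 1)
    (Fin.cons (-Real.sin θ • e 0 + Real.cos θ • e 1) fun i => e i.succ.succ)

lemma rotateFrame_zero (θ : ℝ) :
    rotateFrame e θ 0 = Real.cos θ • e 0 + Real.sin θ • e 1 := rfl

lemma rotateFrame_one (θ : ℝ) :
    rotateFrame e θ 1 = -Real.sin θ • e 0 + Real.cos θ • e 1 := rfl

lemma rotateFrame_succ_succ (θ : ℝ) (i : Fin k) :
    rotateFrame e θ i.succ.succ = e i.succ.succ := rfl

lemma IsOrthonormalFrame.rotateFrame (he : IsOrthonormalFrame f x e) (θ : ℝ) :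
    IsOrthonormalFrame f x (rotateFrame e θ) := by
  have hs := Real.sin_sq_add_cos_sq θ
  have ha : ∀ u v w, metric f x (u + v) w = metric f x u w + metric f x v w := fun u v w => by
    simp [metric, inner_add_left]
  have hc : ∀ (c : ℝ) u w, metric f x (c • u) w = c * metric f x u w := fun c u w => by
    simp [metric, real_inner_smul_left]
  have ha' : ∀ u v w, metric f x w (u + v) = metric f x w u + metric f x w v := fun u v w => by
    simp [metric, inner_add_right]
  have hc' : ∀ (c : ℝ) u w, metric f x w (c • u) = c * metric f x w u := fun c u w => by
    simp [metric, real_inner_smul_right]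
  have h00 : metric f x (e 0) (e 0) = 1 := by rw [he, if_pos rfl]
  have h11 : metric f x (e 1) (e 1) = 1 := by rw [he, if_pos rfl]
  have h01 : metric f x (e 0) (e 1) = 0 := by rw [he, if_neg (by simp)]
  have h10 : metric f x (e 1) (e 0) = 0 := by rw [metric_symm, h01]
  have hi0 : ∀ i : Fin k, metric f x (e i.succ.succ) (e 0) = 0 := fun i => by
    rw [he, if_neg (by simp [Fin.ext_iff])]
  have hi1 : ∀ i : Fin k, metric f x (e i.succ.succ) (e 1) = 0 := fun i => by
    rw [he, if_neg (by simp [Fin.ext_iff])]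
  have h0i : ∀ i : Fin k, metric f x (e 0) (e i.succ.succ) = 0 := fun i => by
    rw [metric_symm, hi0]
  have h1i : ∀ i : Fin k, metric f x (e 1) (e i.succ.succ) = 0 := fun i => by
    rw [metric_symm, hi1]
  intro p q
  rcases eq_zero_or_one_or_succ_succ p with rfl | rfl | ⟨i, rfl⟩ <;>
    rcases eq_zero_or_one_or_succ_succ q with rfl | rfl | ⟨j, rfl⟩ <;>
    simp only [rotateFrame_zero, rotateFrame_one, rotateFrame_succ_succ, ha, hc, ha', hc', h00,
      h11, h01, h10, hi0, hi1, h0i, h1i]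
  · rw [if_pos trivial]; linear_combination hs
  · rw [if_neg (by simp)]; ring
  · rw [if_neg (by simp [Fin.ext_iff])]; ring
  · rw [if_neg (by simp)]; ring
  · rw [if_pos trivial]; linear_combination hs
  · rw [if_neg (by simp [Fin.ext_iff])]; ring
  · rw [if_neg (by simp [Fin.ext_iff])]; ring
  · rw [if_neg (by simp [Fin.ext_iff])]; ring
  · exact he _ _

lemma exists_cos_mul_add_sin_mul_eq_zero (p q : ℝ) :
    ∃ φ : ℝ, Real.cos φ * p + Real.sin φ * q = 0 := by
  refine ⟨Complex.arg ⟨q, -p⟩, ?_⟩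
  have h1 := Complex.norm_mul_cos_arg ⟨q, -p⟩
  have h2 := Complex.norm_mul_sin_arg ⟨q, -p⟩
  by_cases h : ‖(⟨q, -p⟩ : ℂ)‖ = 0
  · rw [norm_eq_zero, Complex.ext_iff] at h
    obtain ⟨hq, hp⟩ := h
    simp only [Complex.zero_re, Complex.zero_im, neg_eq_zero] at hq hp
    simp [hq, hp]
  · have h3 : ‖(⟨q, -p⟩ : ℂ)‖ * (Real.cos (Complex.arg ⟨q, -p⟩) * p
        + Real.sin (Complex.arg ⟨q, -p⟩) * q) = 0 := by
      rw [mul_add, ← mul_assoc, ← mul_assoc, h1, h2]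
      ring
    exact (mul_eq_zero.mp h3).resolve_left h

/-- A frame with `B₂₂ = -B₁₁` can be rotated so that `B₁₁ ⊥ B₁₂`: a rotation by `θ`
turns `⟨B₁₁, B₁₂⟩` into `cos 4θ ⟨B₁₁, B₁₂⟩ + sin 4θ (|B₁₂|² - |B₁₁|²) / 2`. -/
lemma exists_rotateFrame_inner_eq_zero (hf : ContDiffAt ℝ ∞ f x)
    (htr : secondFundForm f x (e 1) (e 1) = -secondFundForm f x (e 0) (e 0)) :
    ∃ θ : ℝ, ⟪secondFundForm f x (rotateFrame e θ 0) (rotateFrame e θ 0),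
      secondFundForm f x (rotateFrame e θ 0) (rotateFrame e θ 1)⟫ = 0 := by
  set a := secondFundForm f x (e 0) (e 0) with ha
  set b := secondFundForm f x (e 0) (e 1) with hb
  obtain ⟨φ, hφ⟩ := exists_cos_mul_add_sin_mul_eq_zero ⟪a, b⟫ ((⟪b, b⟫ - ⟪a, a⟫) / 2)
  have hba : secondFundForm f x (e 1) (e 0) = b := secondFundForm_comm hf _ _
  refine ⟨φ / 4, ?_⟩
  have h2 : φ / 4 = φ / 2 / 2 := by ring
  have h1 : φ = 2 * (φ / 2) := by ring
  rw [h1, Real.cos_two_mul, Real.sin_two_mul] at hφ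
  have hc : Real.cos (φ / 2) = 2 * Real.cos (φ / 4) ^ 2 - 1 := by
    rw [← Real.cos_two_mul]; ring_nf
  have hs : Real.sin (φ / 2) = 2 * Real.sin (φ / 4) * Real.cos (φ / 4) := by
    rw [← Real.sin_two_mul]; ring_nf
  rw [hc, hs] at hφ
  have hcs := Real.sin_sq_add_cos_sq (φ / 4)
  set c := Real.cos (φ / 4)
  set s := Real.sin (φ / 4)
  have hs2 : s ^ 2 = 1 - c ^ 2 := by linarith
  have hA : secondFundForm f x (rotateFrame e (φ / 4) 0) (rotateFrame e (φ / 4) 0)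
      = (2 * c ^ 2 - 1) • a + (2 * s * c) • b := by
    rw [rotateFrame_zero, ← secondFundFormₗ_apply]
    simp only [map_add, map_smul, LinearMap.add_apply, LinearMap.smul_apply,
      secondFundFormₗ_apply, htr, hba, ← ha, ← hb]
    have : (2 * c ^ 2 - 1) = c * c - s * s := by nlinarith
    rw [this]
    module
  have hB : secondFundForm f x (rotateFrame e (φ / 4) 0) (rotateFrame e (φ / 4) 1)
      = (-(2 * s * c)) • a + (2 * c ^ 2 - 1) • b := by
    rw [rotateFrame_zero, rotateFrame_one, ← secondFundFormₗ_apply]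
    simp only [map_add, map_smul, LinearMap.add_apply, LinearMap.smul_apply,
      secondFundFormₗ_apply, htr, hba, ← ha, ← hb]
    have : (2 * c ^ 2 - 1) = c * c - s * s := by nlinarith
    rw [this]
    module
  rw [hA, hB]
  simp only [inner_add_left, inner_add_right, real_inner_smul_left, real_inner_smul_right,
    real_inner_comm a b]
  have hexp : 4 * s ^ 2 * c ^ 2 = 1 - (2 * c ^ 2 - 1) ^ 2 := by rw [hs2]; ring
  linear_combination hφ - ⟪a, b⟫ * hexp

/-- At a point with `B ≠ 0`, a minimal submanifold with Gauss rank at most two has an adapted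
frame, which can be chosen with `B₁₁ ⊥ B₁₂`. -/
lemma exists_isAdaptedFrame (hf : ContDiffAt ℝ ∞ f x)
    (hreg : ∀ᶠ y in nhds x, ContDiffAt ℝ ∞ f y ∧ Function.Injective (fderiv ℝ f y) ∧
      gaussRank f y ≤ 2)
    (hH : ∀ᶠ y in nhds x, meanCurvature f y = 0) (h0 : normB f x ≠ 0) :
    ∃ e, IsAdaptedFrame f x e ∧
      ⟪secondFundForm f x (e 0) (e 0), secondFundForm f x (e 0) (e 1)⟫ = 0 := by
  obtain ⟨-, hinj, hrank⟩ := hreg.self_of_nhds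
  obtain ⟨e, he, hK⟩ := exists_isOrthonormalFrame_adapted hinj _
    (le_finrank_ker_fderiv_gaussMap hrank)
  have hnull : ∀ (i : Fin k) v, secondFundForm f x (e i.succ.succ) v = 0 := fun i v =>
    secondFundForm_eq_zero_of_fderiv_gaussMap_eq_zero hf he (hK i.succ.succ (by simp)) v
  have htr := secondFundForm_trace_of_nullity he hH.self_of_nhds hnull
  have hne : ⟪secondFundForm f x (e 0) (e 0), secondFundForm f x (e 0) (e 0)⟫
      + ⟪secondFundForm f x (e 0) (e 1), secondFundForm f x (e 0) (e 1)⟫ ≠ 0 := fun hh => h0 <| by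
    rw [normB, normSqB_eq_of_nullity hf he hnull htr, hh]
    simp
  obtain ⟨θ, hθ⟩ := exists_rotateFrame_inner_eq_zero hf htr
  refine ⟨rotateFrame e θ, isAdaptedFrame_of_nullity hf (he.rotateFrame θ) hH hnull
    fun w i j => ?_, hθ⟩
  exact covDerivB_eq_zero_of_nullity hf he hreg htr hne (hnull i) (hnull j) w

end Existence

/-! ### The refined Kato inequality for a parametrized minimal submanifold -/

section Local

/-- The structure of `B` and `∇B` in the equality case makes its frame an adapted frame. -/
lemma isAdaptedFrame_of_vanishing {k : ℕ}
    {f : EuclideanSpace ℝ (Fin (k + 2)) → EuclideanSpace ℝ (Fin N)}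
    {x : EuclideanSpace ℝ (Fin (k + 2))} {e : Fin (k + 2) → EuclideanSpace ℝ (Fin (k + 2))}
    (hf : ContDiffAt ℝ ∞ f x) (hH : ∀ᶠ y in nhds x, meanCurvature f y = 0)
    (he : IsOrthonormalFrame f x e)
    (hB : ∀ i j : Fin (k + 2), (2 ≤ i.val ∨ 2 ≤ j.val) → secondFundForm f x (e i) (e j) = 0)
    (hT : ∀ i j l : Fin (k + 2), (2 ≤ i.val ∨ 2 ≤ j.val ∨ 2 ≤ l.val) →
      covDerivB f x (e l) (e i) (e j) = 0) : IsAdaptedFrame f x e := by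
  refine isAdaptedFrame_of_nullity hf he hH (fun i v => ?_) fun w i j => ?_
  · rw [← sum_metric_smul he v, ← secondFundFormₗ_apply, map_sum]
    refine Finset.sum_eq_zero fun l _ => ?_
    rw [map_smul, secondFundFormₗ_apply, hB _ _ (Or.inl (by simp)), smul_zero]
  · rw [← sum_metric_smul he w, ← covDerivBₗ_apply hf he, map_sum, LinearMap.sum_apply,
      LinearMap.sum_apply]
    refine Finset.sum_eq_zero fun l _ => ?_
    rw [map_smul, LinearMap.smul_apply, LinearMap.smul_apply, covDerivBₗ_apply,
      hT _ _ _ (Or.inl (by simp)), smul_zero]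

/-- In codimension one all normal vectors are multiples of one vector. -/
lemma exists_normal_generator {f : EuclideanSpace ℝ (Fin n) → EuclideanSpace ℝ (Fin N)}
    {x : EuclideanSpace ℝ (Fin n)} (hinj : Function.Injective (fderiv ℝ f x)) (hN : N = n + 1) :
    ∃ ν : EuclideanSpace ℝ (Fin N), ∀ ξ, (∀ u, ⟪ξ, fderiv ℝ f x u⟫ = 0) → ∃ c : ℝ, ξ = c • ν := by
  let T := LinearMap.range (fderiv ℝ f x).toLinearMap
  have h1 : Module.finrank ℝ T = n := by
    rw [LinearMap.finrank_range_of_inj hinj, finrank_euclideanSpace_fin]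
  have h2 := T.finrank_add_finrank_orthogonal
  rw [h1, finrank_euclideanSpace_fin] at h2
  obtain ⟨ν, -, hν⟩ := finrank_eq_one_iff'.mp (by omega : Module.finrank ℝ Tᗮ = 1)
  refine ⟨ν, fun ξ hξ => ?_⟩
  have hmem : ξ ∈ Tᗮ := by
    rw [Submodule.mem_orthogonal']
    rintro _ ⟨u, rfl⟩
    exact hξ u
  obtain ⟨c, hc⟩ := hν ⟨ξ, hmem⟩
  exact ⟨c, (congrArg Subtype.val hc).symm⟩

/-- On a minimal surface of codimension one, equality holds in the refined Kato inequality. -/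
lemma IsAdaptedFrame.kato_eq_of_surface
    {f : EuclideanSpace ℝ (Fin (0 + 2)) → EuclideanSpace ℝ (Fin N)}
    {x : EuclideanSpace ℝ (Fin (0 + 2))} {e : Fin (0 + 2) → EuclideanSpace ℝ (Fin (0 + 2))}
    (h : IsAdaptedFrame f x e) (hf : ContDiffAt ℝ ∞ f x)
    (hinj : Function.Injective (fderiv ℝ f x)) (hN : N = 3) (h0 : normB f x ≠ 0) :
    normSqCovDerivB f x = 2 * normSqGrad f (normB f) x := by
  obtain ⟨ν, hν⟩ := exists_normal_generator hinj hN
  obtain ⟨α, ha⟩ := hν _ (inner_secondFundForm_fderiv h.orthonormal (e 0) (e 0))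
  obtain ⟨β, hb⟩ := hν _ (inner_secondFundForm_fderiv h.orthonormal (e 0) (e 1))
  obtain ⟨ξ, hX⟩ := hν _ (inner_covDerivB_fderiv h.orthonormal (e 0) (e 0) (e 0))
  obtain ⟨η, hY⟩ := hν _ (inner_covDerivB_fderiv h.orthonormal (e 0) (e 0) (e 1))
  have hpos := (h.sum_inner_pos hf h0).ne'
  rw [← sub_eq_zero, h.kato_defect hf h0 ha hb hX hY]
  rw [ha, hb] at hpos
  simp only [real_inner_smul_left, real_inner_smul_right] at hpos ⊢
  have hνν : ⟪ν, ν⟫ ≠ 0 := fun hh => hpos (by rw [hh]; ring)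
  have hαβ : α ^ 2 + β ^ 2 ≠ 0 := fun hh => hpos (by linear_combination ⟪ν, ν⟫ * hh)
  simp only [Finset.univ_eq_empty, Finset.sum_empty, add_zero]
  field_simp
  ring

/-- The mean curvature determines `B` on a curve, so that `B = 0` on a minimal submanifold of
dimension at most one. -/
lemma normB_eq_zero_of_lt_two {f : EuclideanSpace ℝ (Fin n) → EuclideanSpace ℝ (Fin N)}
    {x : EuclideanSpace ℝ (Fin n)} (hinj : Function.Injective (fderiv ℝ f x))
    (hH : meanCurvature f x = 0) (hn : n < 2) : normB f x = 0 := by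
  obtain ⟨e, he⟩ := exists_isOrthonormalFrame hinj
  rw [meanCurvature_eq_sum he] at hH
  rw [normB, normSqB_eq_sum he]
  interval_cases n
  · simp
  · simp only [Fin.sum_univ_one] at hH ⊢
    simp [hH]

/-- The refined Kato inequality, with its equality cases, for a minimal immersion of an open set
with Gauss rank at most two. -/
theorem kato_of_isOpen {f : EuclideanSpace ℝ (Fin n) → EuclideanSpace ℝ (Fin N)}
    {U : Set (EuclideanSpace ℝ (Fin n))} (hU : IsOpen U) (hf : ∀ y ∈ U, ContDiffAt ℝ ∞ f y)
    (hinj : ∀ y ∈ U, Function.Injective (fderiv ℝ f y))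
    (hH : ∀ y ∈ U, meanCurvature f y = 0) (hG : ∀ y ∈ U, gaussRank f y ≤ 2)
    {x : EuclideanSpace ℝ (Fin n)} (hx : x ∈ U) (hd : DifferentiableAt ℝ (normB f) x) :
    normSqCovDerivB f x ≥ 2 * normSqGrad f (normB f) x ∧
    (∀ hn : 2 ≤ n, (normSqCovDerivB f x = 2 * normSqGrad f (normB f) x ↔
      EqualityStructure hn f x)) ∧
    (n = 2 → N = 3 → normSqCovDerivB f x = 2 * normSqGrad f (normB f) x) := by
  have hUx : ∀ᶠ y in nhds x, y ∈ U := hU.mem_nhds hx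
  have hfx := hf x hx
  have hHx : ∀ᶠ y in nhds x, meanCurvature f y = 0 := hUx.mono hH
  by_cases h0 : normB f x = 0
  · obtain ⟨e, he⟩ := exists_isOrthonormalFrame (hinj x hx)
    have hB := secondFundForm_eq_zero_of_normB_eq_zero he h0
    have hT := covDerivB_eq_zero_of_normB_eq_zero hfx (hUx.mono hinj) h0 hd
    have h1 : normSqCovDerivB f x = 0 := by
      simp [normSqCovDerivB, hT]
    have h2 : normSqGrad f (normB f) x = 0 := by
      simp [normSqGrad, fderiv_normB_eq_zero h0]
    have h3 : normSqCovDerivB f x = 2 * normSqGrad f (normB f) x := by rw [h1, h2, mul_zero]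
    refine ⟨h3.ge, fun hn => ⟨fun _ => ?_, fun _ => h3⟩, fun _ _ => h3⟩
    exact ⟨e, he, 0, 0, fun i j _ => hB _ _, by simp [hB], fun i j l _ => hT _ _ _,
      by simp [hT], by simp [hT]⟩
  · have hn : 2 ≤ n := by
      by_contra hn
      exact h0 (normB_eq_zero_of_lt_two (hinj x hx) (hH x hx) (not_le.mp hn))
    obtain ⟨k, rfl⟩ : ∃ k, n = k + 2 := ⟨n - 2, by omega⟩
    have hreg : ∀ᶠ y in nhds x, ContDiffAt ℝ ∞ f y ∧ Function.Injective (fderiv ℝ f y) ∧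
        gaussRank f y ≤ 2 := hUx.mono fun y hy => ⟨hf y hy, hinj y hy, hG y hy⟩
    obtain ⟨e, he, hperp⟩ := exists_isAdaptedFrame hfx hreg hHx h0
    refine ⟨he.kato hfx h0, fun hn => ⟨fun heq => ?_, ?_⟩, fun hk hN => ?_⟩
    · obtain ⟨⟨l₁, l₂, hl₁, hl₂⟩, hU⟩ := (he.kato_eq_iff hfx h0).mp heq
      have hcase : ∀ p : Fin (k + 2), 2 ≤ p.val → ∃ i : Fin k, p = i.succ.succ := fun p hp =>
        ⟨⟨p.val - 2, by omega⟩, by ext; simp; omega⟩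
      have hUall : ∀ (i : Fin k) p q, covDerivB f x (e i.succ.succ) (e p) (e q) = 0 := by
        intro i p q
        have hL := covDerivB_comm_left hfx he.orthonormal
        have hR := covDerivB_comm_right hfx
        rcases eq_zero_or_one_or_succ_succ p with rfl | rfl | ⟨j, rfl⟩
        · rcases eq_zero_or_one_or_succ_succ q with rfl | rfl | ⟨j, rfl⟩
          · exact (hU i).1
          · exact (hU i).2
          · rw [hL, he.covNullity]
        · rcases eq_zero_or_one_or_succ_succ q with rfl | rfl | ⟨j, rfl⟩
          · rw [hR]; exact (hU i).2
          · rw [he.covTrace, (hU i).1, neg_zero]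
          · rw [hL, he.covNullity]
        · rw [hR, hL, he.covNullity]
      refine ⟨e, he.orthonormal, l₁, l₂, ?_, hperp, ?_, hl₁, hl₂⟩
      · rintro i j (h | h)
        · obtain ⟨i, rfl⟩ := hcase i h
          exact he.nullity i _
        · obtain ⟨j, rfl⟩ := hcase j h
          rw [secondFundForm_comm hfx]
          exact he.nullity j _
      · rintro i j l (h | h | h)
        · obtain ⟨i, rfl⟩ := hcase i h
          rw [covDerivB_comm_left hfx he.orthonormal, hUall]
        · obtain ⟨j, rfl⟩ := hcase j h
          rw [covDerivB_comm_right hfx, covDerivB_comm_left hfx he.orthonormal, hUall]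
        · obtain ⟨l, rfl⟩ := hcase l h
          exact hUall l i j
    · rintro ⟨e', he', l₁, l₂, hB, -, hT, hl₁, hl₂⟩
      have hadapt := isAdaptedFrame_of_vanishing hfx hHx he' hB hT
      refine (hadapt.kato_eq_iff hfx h0).mpr ⟨⟨l₁, l₂, hl₁, hl₂⟩, fun i => ⟨?_, ?_⟩⟩ <;>
        exact hT _ _ _ (Or.inr (Or.inr (by simp)))
    · obtain rfl : k = 0 := by omega
      exact he.kato_eq_of_surface hfx (hinj x hx) hN h0

end Local

/-! ### Charts of an immersed manifold -/

section Chart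

variable {M : Type*} [TopologicalSpace M] [ChartedSpace (EuclideanSpace ℝ (Fin n)) M]
  {F : M → EuclideanSpace ℝ (Fin N)}
  {φ : OpenPartialHomeomorph M (EuclideanSpace ℝ (Fin n))}

lemma IsSmoothImmersion.contDiffAt_localParam (hF : IsSmoothImmersion n F)
    (hφ : φ ∈ IsManifold.maximalAtlas (𝓡 n) ∞ M) {y : EuclideanSpace ℝ (Fin n)}
    (hy : y ∈ φ.target) : ContDiffAt ℝ ∞ (localParam F φ) y := by
  have h1 := contMDiffOn_symm_of_mem_maximalAtlas hφ
  have h2 : ContMDiffOn (𝓡 n) 𝓘(ℝ, EuclideanSpace ℝ (Fin N)) ∞ (F ∘ φ.symm) φ.target :=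
    hF.smooth.comp_contMDiffOn h1
  exact (contMDiffOn_iff_contDiffOn.mp h2).contDiffAt (φ.open_target.mem_nhds hy)

lemma IsSmoothImmersion.injective_fderiv_localParam (hF : IsSmoothImmersion n F)
    (hφ : φ ∈ IsManifold.maximalAtlas (𝓡 n) ∞ M) {y : EuclideanSpace ℝ (Fin n)}
    (hy : y ∈ φ.target) : Function.Injective (fderiv ℝ (localParam F φ) y) := by
  have hmd : φ.MDifferentiable (𝓡 n) (𝓡 n) :=
    ⟨(contMDiffOn_of_mem_maximalAtlas hφ).mdifferentiableOn (by simp),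
      (contMDiffOn_symm_of_mem_maximalAtlas hφ).mdifferentiableOn (by simp)⟩
  have h1 : MDifferentiableAt (𝓡 n) (𝓡 n) φ.symm y := hmd.mdifferentiableAt_symm hy
  have h2 : MDifferentiableAt (𝓡 n) 𝓘(ℝ, EuclideanSpace ℝ (Fin N)) F (φ.symm y) :=
    hF.smooth.mdifferentiable (by simp) _
  have h3 : Function.Injective (mfderiv (𝓡 n) (𝓡 n) φ.symm y) :=
    hmd.symm.mfderiv_injective hy
  have h4 := mfderiv_comp y h2 h1
  have h5 : Function.Injective
      (mfderiv (𝓡 n) 𝓘(ℝ, EuclideanSpace ℝ (Fin N)) (F ∘ φ.symm) y) := by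
    rw [h4]
    exact (hF.immersion _).comp h3
  rw [mfderiv_eq_fderiv] at h5
  exact h5

end Chart

end MinSub

theorem mainTheorem6 {n m : ℕ} {M : Type*} [TopologicalSpace M]
    [ChartedSpace (EuclideanSpace ℝ (Fin n)) M] [IsManifold (𝓡 n) ∞ M]
    (F : M → EuclideanSpace ℝ (Fin (n + m)))
    (hF : MinSub.IsSmoothImmersion n F) (hmin : MinSub.IsMinimal n F) (hG : MinSub.GRankLE n F 2)
    (p : M) (φ : OpenPartialHomeomorph M (EuclideanSpace ℝ (Fin n)))
    (hφ : φ ∈ IsManifold.maximalAtlas (𝓡 n) ∞ M) (hp : p ∈ φ.source) :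
    (MinSub.normB (MinSub.localParam F φ) (φ p) ≠ 0 →
      DifferentiableAt ℝ (MinSub.normB (MinSub.localParam F φ)) (φ p)) ∧
    (DifferentiableAt ℝ (MinSub.normB (MinSub.localParam F φ)) (φ p) →
      MinSub.normSqCovDerivB (MinSub.localParam F φ) (φ p) ≥
        2 * MinSub.normSqGrad (MinSub.localParam F φ)
          (MinSub.normB (MinSub.localParam F φ)) (φ p) ∧
      (∀ hn : 2 ≤ n,
        (MinSub.normSqCovDerivB (MinSub.localParam F φ) (φ p) =
          2 * MinSub.normSqGrad (MinSub.localParam F φ)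
            (MinSub.normB (MinSub.localParam F φ)) (φ p) ↔
        MinSub.EqualityStructure hn (MinSub.localParam F φ) (φ p))) ∧
      (n = 2 → m = 1 →
        MinSub.normSqCovDerivB (MinSub.localParam F φ) (φ p) =
          2 * MinSub.normSqGrad (MinSub.localParam F φ)
            (MinSub.normB (MinSub.localParam F φ)) (φ p))) := by
  have hx : φ p ∈ φ.target := φ.map_source hp
  have hf := fun y (hy : y ∈ φ.target) => hF.contDiffAt_localParam hφ hy
  have hinj := fun y (hy : y ∈ φ.target) => hF.injective_fderiv_localParam hφ hy
  refine ⟨fun h0 => ?_, fun hd => ?_⟩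
  · obtain ⟨e, he⟩ := MinSub.exists_isOrthonormalFrame (hinj _ hx)
    exact MinSub.differentiableAt_normB (hf _ hx) he h0
  · obtain ⟨h1, h2, h3⟩ := MinSub.kato_of_isOpen φ.open_target hf hinj (hmin φ hφ) (hG φ hφ) hx hd
    exact ⟨h1, h2, fun hn hm => h3 hn (by omega)⟩
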